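/- Let $(X,\omega)$ be a compact connected Kähler manifold of complex dimension $n$, and let $(E,D)$ be a non-Hermitian Yang–Mills (NHYM) bundle over $X$: $E$ is a smooth complex vector bundle and $D$ a smooth connection on $E$ whose curvature $F_D$ is of type $(1,1)$ and satisfies $\sqrt{-1}\,\Lambda_\omega F_D=\lambda\,\mathrm{Id}_E$ for some constant $\lambda\in\mathbb{R}$. Assume that $(E,D)$ is simple, i.e. that $E$ has no $D$-invariant smooth complex subbundle other than $0$ and $E$. For a smooth Hermitian metric $H$ on $E$ let $D=D_H+\psi_H$ be the unique decomposition in which $D_H$ is a connection preserving $H$ and $\psi_H\in\Omega^1(\mathrm{End}\,E)$ is self-adjoint with respect to $H$. The metric $H$ is called harmonic if $D_H^*\psi_H=0$, where $D_H^*$ is the formal adjoint of $D_H:\Omega^0(\mathrm{End}\,E)\to\Omega^1(\mathrm{End}\,E)$ for the $L^2$ inner products defined by $H$, the Kähler metric and the volume form $\omega^n/n!$. If $H_1$ and $H_2$ are two harmonic metrics on $(E,D)$, then there is a constant $c\in\mathbb{R}$ such that $H_1=e^{c}H_2$ on $X$. -/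

import Mathlib

open scoped Manifold ContDiff Bundle
open Bundle MeasureTheory

noncomputable section

namespace NHYM

/-! ### Complex manifolds and complex vector bundles as real smooth objects -/

section Restriction

/-- A complex manifold is in particular a real smooth (even real analytic) manifold. -/
instance isManifoldReal {E : Type*} [NormedAddCommGroup E] [NormedSpace ℂ E]
    {X : Type*} [TopologicalSpace X] [ChartedSpace E X]
    [IsManifold 𝓘(ℂ, E) ω X] : IsManifold 𝓘(ℝ, E) ω X := by
  refine isManifold_of_contDiffOn _ _ _ fun e e' he he' => ?_
  have h := (contDiffGroupoid ω 𝓘(ℂ, E)).compatible (H := E) (M := X) he he'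
  rw [contDiffGroupoid, mem_groupoid_of_pregroupoid] at h
  exact ContDiffOn.restrict_scalars ℝ (𝕜' := ℂ) h.1

/-- Fibres that are topological complex vector spaces are topological real vector spaces. -/
instance (priority := 100) continuousSMulReal {W : Type*} [AddCommGroup W] [Module ℂ W]
    [TopologicalSpace W] [ContinuousSMul ℂ W] : ContinuousSMul ℝ W :=
  ⟨(Complex.continuous_ofReal.comp continuous_fst).smul continuous_snd⟩

variable {X : Type*} [TopologicalSpace X]
  {F : Type*} [NormedAddCommGroup F] [NormedSpace ℂ F]
  {V : X → Type*} [TopologicalSpace (TotalSpace F V)] [∀ x, AddCommGroup (V x)]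
  [∀ x, Module ℂ (V x)] [∀ x, TopologicalSpace (V x)] [FiberBundle F V]

/-- A complex vector bundle is in particular a real vector bundle. -/
instance vectorBundleReal [VectorBundle ℂ F V] : VectorBundle ℝ F V := by
  have hlin : ∀ (e : Trivialization F (π F V)) [MemTrivializationAtlas e], e.IsLinear ℝ := by
    intro e _
    refine ⟨fun b hb => ⟨fun u v => ?_, fun c u => ?_⟩⟩
    · exact (e.linear ℂ hb).map_add u v
    · exact (e.linear ℂ hb).map_smul (c : ℂ) u
  refine ⟨hlin, fun e e' _ _ => ?_⟩
  have := hlin e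
  have := hlin e'
  have h := continuousOn_coordChange ℂ (F := F) (E := V) e e'
  have h2 := (ContinuousLinearMap.continuous_restrictScalars
    (𝕜 := ℂ) (E := F) (F := F) (𝕜' := ℝ) ).comp_continuousOn h
  refine h2.congr fun b hb => ?_
  ext v
  simp [Trivialization.coordChangeL_apply _ _ hb]

theorem finiteDimensional_fiber (F : Type*) [NormedAddCommGroup F] [NormedSpace ℂ F]
    {V : X → Type*} [TopologicalSpace (TotalSpace F V)] [∀ x, AddCommGroup (V x)]
    [∀ x, Module ℂ (V x)] [∀ x, TopologicalSpace (V x)] [FiberBundle F V]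
    [FiniteDimensional ℂ F] [VectorBundle ℂ F V] (x : X) : FiniteDimensional ℂ (V x) :=
  Module.Finite.equiv ((trivializationAt F V x).linearEquivAt ℂ x
    (FiberBundle.mem_baseSet_trivializationAt' x)).symm

end Restriction

/-! ### Kähler forms -/

section Kahler

variable (E : Type*) [NormedAddCommGroup E] [NormedSpace ℂ E]
  {X : Type*} [TopologicalSpace X] [ChartedSpace E X] [IsManifold 𝓘(ℂ, E) ω X]

/-- The real tangent space of `X` at `x`. -/
abbrev RT (x : X) : Type _ := TangentSpace 𝓘(ℝ, E) x

/-- The (almost) complex structure of `X`: multiplication by `i` in a holomorphic chart. -/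
def J (x : X) : RT E x →ₗ[ℝ] RT E x :=
  (LinearMap.restrictScalars ℝ (Complex.I • LinearMap.id : E →ₗ[ℂ] E) : E →ₗ[ℝ] E)

variable {E}

/-- Smooth real vector fields on `X`. -/
def IsSmoothField (Y : Π x : X, RT E x) : Prop :=
  ContMDiff 𝓘(ℝ, E) (𝓘(ℝ, E).prod 𝓘(ℝ, E)) ∞
    (fun x => TotalSpace.mk' E (E := (TangentSpace 𝓘(ℝ, E) : X → Type _)) x (Y x))

variable (E X)

/-- A Kähler form on a complex manifold: a smooth, real, closed, positive `(1,1)`-form. -/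
structure KahlerForm where
  form : Π x : X, RT E x →L[ℝ] RT E x →L[ℝ] ℝ
  skew : ∀ x u v, form x u v = - form x v u
  J_invariant : ∀ x u v, form x (J E x u) (J E x v) = form x u v
  pos : ∀ x u, u ≠ 0 → 0 < form x u (J E x u)
  smooth : ContMDiff 𝓘(ℝ, E) (𝓘(ℝ, E).prod 𝓘(ℝ, E →L[ℝ] E →L[ℝ] ℝ)) ∞
    (fun x => TotalSpace.mk' (E →L[ℝ] E →L[ℝ] ℝ)
      (E := fun x : X => TangentSpace 𝓘(ℝ, E) x →L[ℝ] TangentSpace 𝓘(ℝ, E) x →L[ℝ] ℝ) x (form x))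
  /-- `dω(A, B, C) = 0`, by the invariant formula for the exterior derivative. -/
  closed : ∀ A B C : Π x : X, RT E x,
    IsSmoothField A → IsSmoothField B → IsSmoothField C → ∀ x,
      mvfderiv 𝓘(ℝ, E) (fun y => form y (B y) (C y)) x (A x)
      - mvfderiv 𝓘(ℝ, E) (fun y => form y (A y) (C y)) x (B x)
      + mvfderiv 𝓘(ℝ, E) (fun y => form y (A y) (B y)) x (C x)
      - form x (VectorField.mlieBracket 𝓘(ℝ, E) A B x) (C x)
      + form x (VectorField.mlieBracket 𝓘(ℝ, E) A C x) (B x)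
      - form x (VectorField.mlieBracket 𝓘(ℝ, E) B C x) (A x) = 0

namespace KahlerForm

variable {E X}
variable (κ : KahlerForm E X)

/-- The Riemannian metric `g(u, v) = ω(u, Jv)` of the Kähler form `ω`. -/
def metric (x : X) (u v : RT E x) : ℝ := κ.form x u (J E x v)

variable [FiniteDimensional ℂ E]

/-- The Gram matrix `(g_{ij})` of the metric at `x`, in a basis of `T_x X`. -/
def gram (x : X) :
    Matrix (Fin (Module.finrank ℝ E)) (Fin (Module.finrank ℝ E)) ℝ :=
  Matrix.of fun i j => κ.metric x (Module.finBasis ℝ E i) (Module.finBasis ℝ E j)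

/-- The metric trace `∑ g^{ij} B(b_i, b_j)` of a real bilinear map `B` on `T_x X`; it does not
depend on the basis `b`, and is `∑ B(e_i, e_i)` for an orthonormal basis `e`. -/
def gTrace {W : Type*} [AddCommGroup W] [Module ℝ W] (x : X) (B : RT E x → RT E x → W) : W :=
  ∑ i, ∑ j, (κ.gram x)⁻¹ i j • B (Module.finBasis ℝ E i) (Module.finBasis ℝ E j)

/-- The contraction `Λ_ω α = ½ ∑ α(e_i, J e_i)` of a 2-form with the Kähler form
(`e` an orthonormal basis), normalised by `Λ_ω ω = dim_ℂ X`. -/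
def contract {W : Type*} [AddCommGroup W] [Module ℝ W] (x : X) (α : RT E x → RT E x → W) : W :=
  (1 / 2 : ℝ) • κ.gTrace x (fun u v => α u (J E x v))

/-- The density `√det(g_{ij})` of `ωⁿ/n!` at the point with coordinate `z` in the chart at `p`;
`g_{ij}` are the coefficients of the metric in the coordinate frame of that chart. -/
def chartDensity (p : X) (z : E) : ℝ :=
  Real.sqrt (Matrix.det (Matrix.of fun i j : Fin (Module.finrank ℝ E) =>
    κ.metric ((chartAt E p).symm z)
      (mfderiv 𝓘(ℝ, E) 𝓘(ℝ, E) (chartAt E p).symm z (Module.finBasis ℝ E i))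
      (mfderiv 𝓘(ℝ, E) 𝓘(ℝ, E) (chartAt E p).symm z (Module.finBasis ℝ E j))))

variable (E X) in
/-- A smooth partition of unity `(ρ_p)` on a compact complex manifold, with the support of `ρ_p`
contained in the domain of the chart at `p`. -/
def partition [CompactSpace X] [T2Space X] :
    SmoothPartitionOfUnity X 𝓘(ℝ, E) X Set.univ :=
  (SmoothPartitionOfUnity.exists_isSubordinate_chartAt_source 𝓘(ℝ, E) X).choose

/-- The volume measure `ωⁿ/n!` of a compact Kähler manifold, glued by a partition of unity from
the measures `√det(g_{ij}) dx` in the charts (it does not depend on the partition of unity, by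
the change of variables formula). The Lebesgue measure `dx` is normalised by the basis
in which `g_{ij}` is computed. -/
def volume [MeasurableSpace E] [BorelSpace E] [MeasurableSpace X]
    [CompactSpace X] [T2Space X] : Measure X :=
  Measure.sum fun p : X =>
    Measure.map (chartAt E p).symm
      (((Module.finBasis ℝ E).addHaar.restrict (chartAt E p).target).withDensity fun z =>
        ENNReal.ofReal (partition E X p ((chartAt E p).symm z) * κ.chartDensity p z))

end KahlerForm

end Kahler

/-! ### Complex vector bundles with connections and Hermitian metrics -/

section Bundles

variable {E : Type*} [NormedAddCommGroup E] [NormedSpace ℂ E]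
  {X : Type*} [TopologicalSpace X] [ChartedSpace E X]
  {F : Type*} [NormedAddCommGroup F] [NormedSpace ℂ F]
  {V : X → Type*} [TopologicalSpace (TotalSpace F V)] [∀ x, AddCommGroup (V x)]
  [∀ x, Module ℂ (V x)] [∀ x, TopologicalSpace (V x)] [FiberBundle F V]

variable (E F) in
/-- The section `σ` of the bundle is (real) smooth at the point `x`. -/
def SmoothSectionAt (σ : Π x : X, V x) (x : X) : Prop :=
  ContMDiffAt 𝓘(ℝ, E) (𝓘(ℝ, E).prod 𝓘(ℝ, F)) ∞ (fun y => TotalSpace.mk' F y (σ y)) x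

variable (E F V) in
/-- A smooth Hermitian metric on a complex vector bundle, complex linear in the first variable. -/
structure HermitianMetric where
  form : Π x : X, V x →ₗ[ℂ] V x →ₗ⋆[ℂ] ℂ
  symm : ∀ x u v, form x u v = starRingEnd ℂ (form x v u)
  pos : ∀ x u, u ≠ 0 → 0 < (form x u u).re
  smooth : ∀ σ τ : Π x : X, V x, ∀ x, SmoothSectionAt E F σ x → SmoothSectionAt E F τ x →
    ContMDiffAt 𝓘(ℝ, E) 𝓘(ℝ, ℂ) ∞ (fun y => form y (σ y) (τ y)) x

namespace HermitianMetric

variable (H : HermitianMetric E F V)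

/-- The Hermitian metric on the fibre at `x`, in Mathlib's convention for inner products
(complex linear in the second variable). -/
@[reducible] def core (x : X) : InnerProductSpace.Core ℂ (V x) where
  inner u v := H.form x v u
  conj_inner_symm u v := (H.symm x v u).symm
  re_inner_nonneg u := by
    by_cases h : u = 0
    · simp [h]
    · exact (H.pos x u h).le
  add_left u v w := by simp
  smul_left u v r := by simp
  definite u h := by
    by_contra hu
    have h1 := H.pos x u hu
    have h2 : H.form x u u = 0 := h
    simp [h2] at h1

/-- The adjoint `A^{*H}` of an endomorphism of the fibre at `x`. -/
def adj [FiniteDimensional ℂ F] [VectorBundle ℂ F V] (x : X) (A : Module.End ℂ (V x)) :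
    Module.End ℂ (V x) :=
  letI := H.core x
  letI : NormedAddCommGroup (V x) := InnerProductSpace.Core.toNormedAddCommGroup (𝕜 := ℂ)
  letI : InnerProductSpace ℂ (V x) := InnerProductSpace.ofCore (H.core x).toCore
  haveI : FiniteDimensional ℂ (V x) := finiteDimensional_fiber F x
  LinearMap.adjoint A

theorem form_adj [FiniteDimensional ℂ F] [VectorBundle ℂ F V] (x : X) (A : Module.End ℂ (V x))
    (u v : V x) : H.form x (A u) v = H.form x u (H.adj x A v) := by
  let := H.core x
  let : NormedAddCommGroup (V x) := InnerProductSpace.Core.toNormedAddCommGroup (𝕜 := ℂ)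
  let : InnerProductSpace ℂ (V x) := InnerProductSpace.ofCore (H.core x).toCore
  have : FiniteDimensional ℂ (V x) := finiteDimensional_fiber F x
  exact (LinearMap.adjoint_inner_left A u v).symm

/-- The induced inner product `⟨A, B⟩_H = tr(A ∘ B^{*H})` on endomorphisms. -/
def endInner [FiniteDimensional ℂ F] [VectorBundle ℂ F V] (x : X) (A B : Module.End ℂ (V x)) : ℂ :=
  LinearMap.trace ℂ (V x) (A ∘ₗ H.adj x B)

end HermitianMetric

variable [IsManifold 𝓘(ℂ, E) ω X]

variable (V) in
/-- Sections of `End(V)`. -/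
abbrev EndSection : Type _ := Π x : X, Module.End ℂ (V x)

variable (E V) in
/-- Real 1-forms with values in `End(V)`. -/
abbrev EndForm : Type _ := Π x : X, RT E x →ₗ[ℝ] Module.End ℂ (V x)

variable (E F) in
/-- Smooth sections of `End(V)`: those which preserve smoothness of sections of `V`. -/
def IsSmoothEnd (φ : EndSection V) : Prop :=
  ∀ (σ : Π x : X, V x) (x : X), SmoothSectionAt E F σ x →
    SmoothSectionAt E F (fun y => φ y (σ y)) x

variable (F) in
/-- Smooth 1-forms with values in `End(V)`. -/
def IsSmoothEndForm (ψ : EndForm E V) : Prop :=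
  ∀ (Y : Π x : X, RT E x), IsSmoothField Y → IsSmoothEnd E F (fun x => ψ x (Y x))

variable (E V) in
/-- First order operators sending a section `σ` to `(x, v) ↦ (∇_v σ)(x)`. -/
abbrev Nabla : Type _ := (Π x : X, V x) → Π x : X, RT E x → V x

/-- The connection `D - ψ`. -/
def subForm (D : Nabla E V) (ψ : EndForm E V) : Nabla E V :=
  fun σ x v => D σ x v - ψ x v (σ x)

/-- The operator `∇` preserves the Hermitian metric:
`d(H(σ, τ)) = H(∇σ, τ) + H(σ, ∇τ)`. -/
def IsUnitary (H : HermitianMetric E F V) (D : Nabla E V) : Prop :=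
  ∀ (σ τ : Π x : X, V x) (x : X) (v : RT E x),
    SmoothSectionAt E F σ x → SmoothSectionAt E F τ x →
      mvfderiv 𝓘(ℝ, E) (fun y => H.form y (σ y) (τ y)) x v =
        H.form x (D σ x v) (τ x) + H.form x (σ x) (D τ x v)

/-- `ψ` is the 1-form `ψ_H` of the unique decomposition `D = D_H + ψ_H` into a connection `D_H`
which preserves `H` and a smooth 1-form `ψ_H` with values in the `H`-self-adjoint
endomorphisms. -/
structure IsSelfAdjointPart (D : Nabla E V) (H : HermitianMetric E F V) (ψ : EndForm E V) :
    Prop where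
  smooth : IsSmoothEndForm F ψ
  selfAdjoint : ∀ x v u w, H.form x (ψ x v u) w = H.form x u (ψ x v w)
  unitary : IsUnitary H (subForm D ψ)

variable (F) in
/-- `Dφ` is the covariant derivative of the section `φ` of `End(V)`:
`(∇φ)(σ) = ∇(φσ) - φ(∇σ)`. -/
def IsEndDeriv (D : Nabla E V) (φ : EndSection V) (Dφ : EndForm E V) : Prop :=
  ∀ (σ : Π x : X, V x) (x : X) (v : RT E x), SmoothSectionAt E F σ x →
    Dφ x v (σ x) = D (fun y => φ y (σ y)) x v - φ x (D σ x v)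

/-- `η = ∇^* ψ`, where `∇^*` is the formal adjoint of `∇ : Ω⁰(End V) → Ω¹(End V)` with respect
to the `L²` inner products given by `H`, the Kähler metric and its volume `ωⁿ/n!`:
`∫ ⟨∇φ, ψ⟩ = ∫ ⟨φ, η⟩` for all smooth sections `φ` of `End(V)`. -/
def IsCodifferential [FiniteDimensional ℂ E] [FiniteDimensional ℂ F] [VectorBundle ℂ F V]
    [MeasurableSpace E] [BorelSpace E] [MeasurableSpace X]
    [CompactSpace X] [T2Space X]
    (κ : KahlerForm E X) (H : HermitianMetric E F V) (D : Nabla E V)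
    (ψ : EndForm E V) (η : EndSection V) : Prop :=
  ∀ (φ : EndSection V) (Dφ : EndForm E V), IsSmoothEnd E F φ → IsEndDeriv F D φ Dφ →
    ∫ x, κ.gTrace x (fun u v => H.endInner x (Dφ x u) (ψ x v)) ∂κ.volume =
      ∫ x, H.endInner x (φ x) (η x) ∂κ.volume

/-- `H` is a harmonic metric for `D`: `D_H^* ψ_H = 0`, where `D = D_H + ψ_H` is the
decomposition of `D` into its unitary and self-adjoint parts. -/
def IsHarmonic [FiniteDimensional ℂ E] [FiniteDimensional ℂ F] [VectorBundle ℂ F V]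
    [MeasurableSpace E] [BorelSpace E] [MeasurableSpace X]
    [CompactSpace X] [T2Space X]
    (κ : KahlerForm E X) (D : Nabla E V) (H : HermitianMetric E F V) : Prop :=
  ∃ ψ : EndForm E V, IsSelfAdjointPart D H ψ ∧ IsCodifferential κ H (subForm D ψ) ψ 0

variable (F) in
/-- `S` is a smooth complex subbundle of `V`: it has local smooth frames. -/
def IsSubbundle (E : Type*) [NormedAddCommGroup E] [NormedSpace ℂ E] [ChartedSpace E X]
    (S : Π x : X, Submodule ℂ (V x)) : Prop :=
  ∀ x : X, ∃ U : Set X, IsOpen U ∧ x ∈ U ∧ ∃ (k : ℕ) (s : Fin k → Π y : X, V y),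
    ∀ y ∈ U, (∀ i, SmoothSectionAt E F (s i) y) ∧ LinearIndependent ℂ (fun i => s i y) ∧
      Submodule.span ℂ (Set.range fun i => s i y) = S y

variable (F) in
/-- `D` maps sections of `S` to 1-forms with values in `S`. -/
def IsInvariant (D : Nabla E V) (S : Π x : X, Submodule ℂ (V x)) : Prop :=
  ∀ (σ : Π x : X, V x) (x : X) (v : RT E x), SmoothSectionAt E F σ x →
    (∀ᶠ y in nhds x, σ y ∈ S y) → D σ x v ∈ S x

variable (F) in
/-- `(V, D)` is simple: it has no `D`-invariant subbundles other than `0` and `V`. -/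
def IsSimple (D : Nabla E V) : Prop :=
  ∀ S : Π x : X, Submodule ℂ (V x), IsSubbundle F E S → IsInvariant F D S →
    (∀ x, S x = ⊥) ∨ (∀ x, S x = ⊤)

variable (F) in
/-- `R` is the curvature `F_D` of the connection `D`:
`F_D(A, B) σ = D_A D_B σ - D_B D_A σ - D_{[A, B]} σ`. -/
def IsCurvature (D : Nabla E V) (R : Π x : X, RT E x →ₗ[ℝ] RT E x →ₗ[ℝ] Module.End ℂ (V x)) :
    Prop :=
  ∀ (A B : Π x : X, RT E x) (σ : Π x : X, V x), IsSmoothField A → IsSmoothField B →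
    (∀ x, SmoothSectionAt E F σ x) → ∀ x,
      R x (A x) (B x) (σ x) =
        D (fun y => D σ y (B y)) x (A x) - D (fun y => D σ y (A y)) x (B x)
          - D σ x (VectorField.mlieBracket 𝓘(ℝ, E) A B x)

variable [∀ x, IsTopologicalAddGroup (V x)] [∀ x, ContinuousSMul ℂ (V x)]
  [VectorBundle ℂ F V]

/-- The operator underlying a covariant derivative. -/
def toNabla (D : CovariantDerivative 𝓘(ℝ, E) F V) : Nabla E V := fun σ x v => D σ x v

/-- A connection on the complex vector bundle `V`: a smooth covariant derivative which is
complex linear (so that the Leibniz rule holds for complex functions). -/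
structure IsComplexConnection (D : CovariantDerivative 𝓘(ℝ, E) F V) : Prop where
  smooth : CovariantDerivative.ContMDiffCovariantDerivative D ∞
  linear : ∀ (σ : Π x : X, V x) (x : X) (v : RT E x),
    MDifferentiableAt 𝓘(ℝ, E) (𝓘(ℝ, E).prod 𝓘(ℝ, F)) (fun y => TotalSpace.mk' F y (σ y)) x →
      D (fun y => Complex.I • σ y) x v = Complex.I • D σ x v

/-- `D` is a non-Hermitian Yang-Mills connection: its curvature is of type `(1,1)` and
`√-1 Λ_ω F_D = λ Id` for a real constant `λ`. -/
structure IsNHYM [FiniteDimensional ℂ E] (κ : KahlerForm E X)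
    (D : CovariantDerivative 𝓘(ℝ, E) F V) : Prop where
  connection : IsComplexConnection D
  curvature : ∃ R : Π x : X, RT E x →ₗ[ℝ] RT E x →ₗ[ℝ] Module.End ℂ (V x),
    IsCurvature F (toNabla D) R ∧
    (∀ x u v, R x (J E x u) (J E x v) = R x u v) ∧
    ∃ l : ℝ, ∀ x, Complex.I • κ.contract x (fun u v => R x u v) =
      (l : ℂ) • (LinearMap.id : Module.End ℂ (V x))

end Bundles

end NHYM

end

/-! Let `h = H₁.rel H₂` be the endomorphism with `H₂(u, w) = H₁(h u, w)`, and let `ψ₁`, `ψ₂` be the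
self-adjoint parts of `D`. Differentiating this relation and using that `D - ψᵢ` preserves `Hᵢ`
gives `Dh = 2(ψ₁ h - h ψ₂)` (`nabla_rel`).

Each harmonicity condition is tested against the same endomorphism `h`. Since `ψᵢ` is
`Hᵢ`-self-adjoint, the integrands are metric traces of `tr((D_{Hᵢ} h) ψᵢ)`, with no adjoint left. By
cyclicity of the trace, their difference is twice the metric trace of `tr((ψ₁ h - h ψ₂)(ψ₁ - ψ₂))`
(`gTrace_sub_gTrace`), and this is the squared norm of `ψ₁ - ψ₂` measured with `H₁` on one side and
`H₂` on the other, hence nonnegative (`gTrace_relForm_nonneg`). Its integral is zero, so `ψ₁ = ψ₂`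
(`selfAdjointPart_eq`).

The common form is self-adjoint for both metrics, so it commutes with `h`, and then `Dh = 0`. A
parallel self-adjoint endomorphism has constant spectrum, and its eigenspaces are `D`-invariant
subbundles; simplicity forces `h = μ Id` (`IsSimple.eq_smul_of_isParallel`), and positivity of the
metrics makes `μ` a positive real number.

The rest is the analysis behind the integral argument: the integrands are continuous, and the glued
volume is finite and charges every nonempty open set. -/

noncomputable section

set_option linter.unusedSectionVars false

namespace NHYM

/-! ### Metric traces of bilinear maps -/

section LinearAlgebra

variable {M W : Type*} [AddCommGroup M] [Module ℝ M] [AddCommGroup W] [Module ℝ W]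
  {ι : Type*} [Fintype ι] [DecidableEq ι]

/-- The Gram matrix of a symmetric positive definite bilinear form is positive definite. -/
theorem gramMatrix_posDef (g : M →ₗ[ℝ] M →ₗ[ℝ] ℝ) (hs : ∀ u v, g u v = g v u)
    (hp : ∀ u, u ≠ 0 → 0 < g u u) (b : Module.Basis ι ℝ M) :
    (Matrix.of fun i j => g (b i) (b j)).PosDef := by
  refine Matrix.PosDef.of_dotProduct_mulVec_pos (Matrix.IsHermitian.ext fun i j => by simp [hs]) ?_
  intro c hc
  have key : star c ⬝ᵥ (Matrix.of fun i j => g (b i) (b j)).mulVec c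
      = g (∑ i, c i • b i) (∑ i, c i • b i) := by
    simp only [dotProduct, Matrix.mulVec, Finset.mul_sum, star_trivial, Matrix.of_apply, map_sum,
      map_smul, LinearMap.sum_apply, LinearMap.smul_apply, smul_eq_mul]
    rw [Finset.sum_comm]
    exact Finset.sum_congr rfl fun i _ => Finset.sum_congr rfl fun j _ => by ring
  rw [key]
  refine hp _ fun h => hc ?_
  funext i
  exact Fintype.linearIndependent_iff.1 b.linearIndependent c h i

/-- The metric trace of a bilinear map computed in a basis. -/
def basisTrace (g : M →ₗ[ℝ] M →ₗ[ℝ] ℝ) (b : ι → M) (B : M →ₗ[ℝ] M →ₗ[ℝ] W) : W :=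
  ∑ i, ∑ j, (Matrix.of fun i j => g (b i) (b j))⁻¹ i j • B (b i) (b j)

theorem sum_smul_bilinear (B : M →ₗ[ℝ] M →ₗ[ℝ] W) (b : ι → M) (A P : Matrix ι ι ℝ) :
    ∑ i, ∑ j, P i j • B (∑ k, A i k • b k) (∑ k, A j k • b k) =
      ∑ k, ∑ l, (A.transpose * P * A) k l • B (b k) (b l) := by
  have e1 : ∀ i j, P i j • B (∑ k, A i k • b k) (∑ k, A j k • b k) =
      ∑ k, ∑ l, (A i k * P i j * A j l) • B (b k) (b l) := by
    intro i j
    simp only [map_sum, map_smul, LinearMap.sum_apply, LinearMap.smul_apply, Finset.smul_sum,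
      smul_smul]
    rw [Finset.sum_comm]
    refine Finset.sum_congr rfl fun k _ => Finset.sum_congr rfl fun l _ => ?_
    congr 1
    ring
  have e2 : ∀ k l, (A.transpose * P * A) k l • B (b k) (b l) =
      ∑ i, ∑ j, (A i k * P i j * A j l) • B (b k) (b l) := by
    intro k l
    simp only [Matrix.mul_apply, Matrix.transpose_apply, Finset.sum_mul, Finset.sum_smul]
    rw [Finset.sum_comm]
  simp only [e1, e2]
  calc _ = ∑ i, ∑ k, ∑ j, ∑ l, (A i k * P i j * A j l) • B (b k) (b l) :=
        Finset.sum_congr rfl fun i _ => Finset.sum_comm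
    _ = ∑ k, ∑ i, ∑ l, ∑ j, (A i k * P i j * A j l) • B (b k) (b l) := by
        rw [Finset.sum_comm]
        exact Finset.sum_congr rfl fun k _ => Finset.sum_congr rfl fun i _ => Finset.sum_comm
    _ = _ := Finset.sum_congr rfl fun k _ => Finset.sum_comm

/-- The Gram matrix changes by `G' = A G Aᵀ`, so its inverse compensates the change of the
coefficients of `B`. This allows `gTrace` to be computed in coordinate frames. -/
theorem basisTrace_eq (g : M →ₗ[ℝ] M →ₗ[ℝ] ℝ) (hs : ∀ u v, g u v = g v u)
    (hp : ∀ u, u ≠ 0 → 0 < g u u) (b b' : Module.Basis ι ℝ M) (B : M →ₗ[ℝ] M →ₗ[ℝ] W) :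
    basisTrace g b B = basisTrace g b' B := by
  set A : Matrix ι ι ℝ := Matrix.of fun i k => b.repr (b' i) k with hA
  have hb : ∀ i, b' i = ∑ k, A i k • b k := fun i => (b.sum_repr (b' i)).symm
  set G : Matrix ι ι ℝ := Matrix.of fun i j => g (b i) (b j) with hG
  set G' : Matrix ι ι ℝ := Matrix.of fun i j => g (b' i) (b' j) with hG'
  have hGA : G' = A * G * A.transpose := by
    ext i j
    simp only [hG', Matrix.of_apply]
    rw [hb i, hb j]
    simp only [map_sum, map_smul, LinearMap.sum_apply, LinearMap.smul_apply, smul_eq_mul,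
      Matrix.mul_apply, Matrix.transpose_apply, Finset.sum_mul, hG, Matrix.of_apply]
    refine Finset.sum_congr rfl fun k _ => ?_
    simp only [Finset.mul_sum]
    exact Finset.sum_congr rfl fun l _ => by ring
  have hG'u : IsUnit G'.det := (gramMatrix_posDef g hs hp b').det_pos.ne'.isUnit
  have hGu : IsUnit G.det := (gramMatrix_posDef g hs hp b).det_pos.ne'.isUnit
  have hAu : IsUnit A.det := by
    have := hG'u
    rw [hGA, Matrix.det_mul, Matrix.det_mul] at this
    exact isUnit_of_mul_isUnit_left (isUnit_of_mul_isUnit_left this)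
  have hinv : A.transpose * G'⁻¹ * A = G⁻¹ := by
    have hAt : IsUnit A.transpose.det := by rwa [Matrix.det_transpose]
    rw [hGA, Matrix.mul_inv_rev, Matrix.mul_inv_rev, ← Matrix.mul_assoc,
      Matrix.mul_nonsing_inv _ hAt, Matrix.one_mul, Matrix.mul_assoc,
      Matrix.nonsing_inv_mul _ hAu, Matrix.mul_one]
  unfold basisTrace
  rw [← hG, ← hG']
  simp only [hb]
  rw [sum_smul_bilinear, hinv]

/-- The metric trace of a positive semidefinite form is nonnegative, and it vanishes only if
the form is zero on the diagonal. -/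
theorem basisTrace_nonneg {N : Type*} [AddCommGroup N] [Module ℝ N]
    (g : M →ₗ[ℝ] M →ₗ[ℝ] ℝ) (hs : ∀ u v, g u v = g v u)
    (hp : ∀ u, u ≠ 0 → 0 < g u u) (b : Module.Basis ι ℝ M) (B : M →ₗ[ℝ] M →ₗ[ℝ] ℝ)
    (d : M →ₗ[ℝ] N) (h0 : ∀ u, 0 ≤ B u u) (h1 : ∀ u, B u u = 0 → d u = 0) :
    0 ≤ basisTrace g b B ∧ (basisTrace g b B = 0 → d = 0) := by
  have hpd := (gramMatrix_posDef g hs hp b).inv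
  set G : Matrix ι ι ℝ := Matrix.of fun i j => g (b i) (b j) with hG
  -- The rows of `C` are the coefficients of a `g`-orthonormal basis; in it the trace is the sum of
  -- the diagonal values of `B`.
  obtain ⟨C, hC⟩ : ∃ C : Matrix ι ι ℝ, G⁻¹ = star C * C := by
    open scoped MatrixOrder Matrix.Norms.L2Operator in
    exact CStarAlgebra.nonneg_iff_eq_star_mul_self.1 hpd.posSemidef.nonneg
  have hC' : G⁻¹ = C.transpose * 1 * C := by rw [hC, Matrix.mul_one]; rfl
  have hCu : IsUnit C.det := by
    have := hpd.det_pos.ne'.isUnit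
    rw [hC', Matrix.det_mul] at this
    exact isUnit_of_mul_isUnit_right this
  have key : basisTrace g b B = ∑ i, B (∑ k, C i k • b k) (∑ k, C i k • b k) := by
    unfold basisTrace
    rw [← hG, hC', ← sum_smul_bilinear]
    refine Finset.sum_congr rfl fun i _ => ?_
    simp [Matrix.one_apply]
  rw [key]
  refine ⟨Finset.sum_nonneg fun i _ => h0 _, fun h => ?_⟩
  rw [Finset.sum_eq_zero_iff_of_nonneg fun i _ => h0 _] at h
  refine b.ext fun l => ?_
  have hl : b l = ∑ i, C⁻¹ l i • ∑ k, C i k • b k := by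
    have : ∀ k, ∑ i, C⁻¹ l i * C i k = (1 : Matrix ι ι ℝ) l k := fun k => by
      rw [← Matrix.mul_apply, Matrix.nonsing_inv_mul _ hCu]
    simp only [Finset.smul_sum, smul_smul]
    rw [Finset.sum_comm]
    simp only [← Finset.sum_smul, this]
    simp [Matrix.one_apply]
  rw [hl, map_sum]
  simp only [map_smul, h1 _ (h _ (Finset.mem_univ _))]
  simp

/-- The inverse Gram matrix is symmetric, so the metric trace does not see antisymmetric parts. -/
theorem basisTrace_flip (g : M →ₗ[ℝ] M →ₗ[ℝ] ℝ) (hs : ∀ u v, g u v = g v u) (b : ι → M)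
    (B : M →ₗ[ℝ] M →ₗ[ℝ] W) : basisTrace g b B.flip = basisTrace g b B := by
  unfold basisTrace
  rw [Finset.sum_comm]
  refine Finset.sum_congr rfl fun i _ => Finset.sum_congr rfl fun j _ => ?_
  have hT : (Matrix.of fun i j => g (b i) (b j)).transpose = Matrix.of fun i j => g (b i) (b j) := by
    ext i j
    simp [hs]
  rw [LinearMap.flip_apply]
  nth_rewrite 1 [← hT]
  rw [← Matrix.transpose_nonsing_inv, Matrix.transpose_apply]

theorem basisTrace_sub (g : M →ₗ[ℝ] M →ₗ[ℝ] ℝ) (b : ι → M)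
    (B B' : M →ₗ[ℝ] M →ₗ[ℝ] W) :
    basisTrace g b (B - B') = basisTrace g b B - basisTrace g b B' := by
  simp [basisTrace, smul_sub]

end LinearAlgebra

/-! ### The Riemannian metric of a Kähler form -/

namespace KahlerForm

variable {E : Type*} [NormedAddCommGroup E] [NormedSpace ℂ E]
  {X : Type*} [TopologicalSpace X] [ChartedSpace E X] [IsManifold 𝓘(ℂ, E) ω X]
  (κ : KahlerForm E X)

/-- The metric of a Kähler form as a bilinear form. -/
def metricₗ (x : X) : RT E x →ₗ[ℝ] RT E x →ₗ[ℝ] ℝ :=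
  LinearMap.mk₂ ℝ (κ.metric x) (fun u v w => by simp [metric]) (fun c u v => by simp [metric])
    (fun u v w => by simp [metric]) (fun c u v => by simp [metric])

theorem J_J (x : X) (u : RT E x) : J E x (J E x u) = -u := by
  have h : ∀ w : E, Complex.I • Complex.I • w = -w := fun w => by
    rw [smul_smul, Complex.I_mul_I, neg_one_smul]
  exact h u

theorem metric_symm (x : X) (u v : RT E x) : κ.metricₗ x u v = κ.metricₗ x v u := by
  change κ.form x u (J E x v) = κ.form x v (J E x u)
  rw [← κ.J_invariant x v, J_J, map_neg, κ.skew x u]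

theorem metric_pos (x : X) (u : RT E x) (hu : u ≠ 0) : 0 < κ.metricₗ x u u := κ.pos x u hu

variable [FiniteDimensional ℂ E]

theorem gTrace_eq_basisTrace {W : Type*} [AddCommGroup W] [Module ℝ W] (x : X)
    (B : RT E x →ₗ[ℝ] RT E x →ₗ[ℝ] W) (b : Module.Basis (Fin (Module.finrank ℝ E)) ℝ (RT E x)) :
    κ.gTrace x (fun u v => B u v) = basisTrace (κ.metricₗ x) b B :=
  basisTrace_eq (κ.metricₗ x) (κ.metric_symm x) (κ.metric_pos x)
    (Module.finBasis ℝ E : Module.Basis _ ℝ (RT E x)) b B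

end KahlerForm

/-! ### Smooth sections and endomorphisms in local trivializations -/

section Sections

variable {E : Type*} [NormedAddCommGroup E] [NormedSpace ℂ E]
  {X : Type*} [TopologicalSpace X] [ChartedSpace E X]
  {F : Type*} [NormedAddCommGroup F] [NormedSpace ℂ F]
  {V : X → Type*} [TopologicalSpace (TotalSpace F V)] [∀ x, AddCommGroup (V x)]
  [∀ x, Module ℂ (V x)] [∀ x, TopologicalSpace (V x)] [FiberBundle F V] [VectorBundle ℂ F V]

variable (F) in
/-- The coordinate of a vector of `V y` in the preferred trivialization at `p`. -/
def coord (p y : X) : V y →ₗ[ℂ] F := (trivializationAt F V p).linearMapAt ℂ y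

variable (V) in
/-- The local section which is constant in the preferred trivialization at `p`. -/
def frame (p y : X) : F →ₗ[ℂ] V y := (trivializationAt F V p).symmₗ ℂ y

variable (F V) in
/-- The domain of the preferred trivialization at `p`. -/
def dom (p : X) : Set X := (trivializationAt F V p).baseSet

theorem mem_dom (p : X) : p ∈ dom F V p := FiberBundle.mem_baseSet_trivializationAt' p

theorem dom_mem_nhds {p x : X} (hx : x ∈ dom F V p) : dom F V p ∈ nhds x :=
  (trivializationAt F V p).open_baseSet.mem_nhds hx

theorem coord_frame {p y : X} (hy : y ∈ dom F V p) (w : F) : coord F p y (frame V p y w) = w :=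
  (trivializationAt F V p).linearMapAt_symmₗ hy w

theorem frame_coord {p y : X} (hy : y ∈ dom F V p) (u : V y) : frame V p y (coord F p y u) = u :=
  (trivializationAt F V p).symmₗ_linearMapAt hy u

/-- The coordinate map as a linear equivalence. -/
def coordEquiv {p y : X} (hy : y ∈ dom F V p) : V y ≃ₗ[ℂ] F :=
  { coord F p y with
    invFun := frame V p y
    left_inv := frame_coord hy
    right_inv := coord_frame hy }

variable [ContMDiffVectorBundle ∞ F V 𝓘(ℝ, E)]

theorem smoothSectionAt_iff {σ : Π x : X, V x} {p x : X} (hx : x ∈ dom F V p) :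
    SmoothSectionAt E F σ x ↔
      ContMDiffAt 𝓘(ℝ, E) 𝓘(ℝ, F) ∞ (fun y => coord F p y (σ y)) x := by
  unfold SmoothSectionAt
  rw [(trivializationAt F V p).contMDiffAt_section_iff (𝕜 := ℝ) (IB := 𝓘(ℝ, E)) hx]
  refine Filter.EventuallyEq.contMDiffAt_iff ?_
  filter_upwards [dom_mem_nhds hx] with y hy
  exact (congrFun ((trivializationAt F V p).coe_linearMapAt_of_mem (R := ℂ) hy) (σ y)).symm

theorem smoothSectionAt_frame {p x : X} (hx : x ∈ dom F V p) (w : F) :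
    SmoothSectionAt E F (fun y => frame V p y w) x := by
  rw [smoothSectionAt_iff hx]
  refine (contMDiffAt_const (c := w)).congr_of_eventuallyEq ?_
  filter_upwards [dom_mem_nhds hx] with y hy
  exact coord_frame hy w

theorem SmoothSectionAt.congr {σ τ : Π x : X, V x} {x : X} (h : SmoothSectionAt E F σ x)
    (hst : ∀ᶠ y in nhds x, τ y = σ y) : SmoothSectionAt E F τ x := by
  rw [smoothSectionAt_iff (mem_dom x)] at h ⊢
  refine h.congr_of_eventuallyEq ?_
  filter_upwards [hst] with y hy
  rw [hy]

theorem SmoothSectionAt.add {σ τ : Π x : X, V x} {x : X} (hσ : SmoothSectionAt E F σ x)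
    (hτ : SmoothSectionAt E F τ x) : SmoothSectionAt E F (fun y => σ y + τ y) x := by
  rw [smoothSectionAt_iff (mem_dom x)] at *
  simpa only [map_add] using! hσ.add hτ

theorem SmoothSectionAt.sub {σ τ : Π x : X, V x} {x : X} (hσ : SmoothSectionAt E F σ x)
    (hτ : SmoothSectionAt E F τ x) : SmoothSectionAt E F (fun y => σ y - τ y) x := by
  rw [smoothSectionAt_iff (mem_dom x)] at *
  simpa only [map_sub] using! hσ.sub hτ

theorem SmoothSectionAt.smul {f : X → ℂ} {σ : Π x : X, V x} {x : X}
    (hf : ContMDiffAt 𝓘(ℝ, E) 𝓘(ℝ, ℂ) ∞ f x) (hσ : SmoothSectionAt E F σ x) :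
    SmoothSectionAt E F (fun y => f y • σ y) x := by
  rw [smoothSectionAt_iff (mem_dom x)] at *
  simp only [map_smul]
  exact ((contDiff_smul (𝕜 := ℝ) (n := ∞) (F := F) (𝕜' := ℂ)).contMDiff.contMDiffAt).comp x
    (hf.prodMk_space hσ)

theorem SmoothSectionAt.sum {ι : Type*} {s : Finset ι} {σ : ι → Π x : X, V x} {x : X}
    (hσ : ∀ i ∈ s, SmoothSectionAt E F (σ i) x) :
    SmoothSectionAt E F (fun y => ∑ i ∈ s, σ i y) x := by
  simp only [smoothSectionAt_iff (mem_dom x)] at *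
  simp only [map_sum]
  exact contMDiffAt_finsetSum hσ

variable (E F) in
theorem exists_smoothSectionAt (x : X) (u : V x) :
    ∃ σ : Π x : X, V x, SmoothSectionAt E F σ x ∧ σ x = u :=
  ⟨_, smoothSectionAt_frame (mem_dom x) (coord F x x u), frame_coord (mem_dom x) u⟩

theorem IsSmoothEnd.add {φ χ : EndSection V} (hφ : IsSmoothEnd E F φ) (hχ : IsSmoothEnd E F χ) :
    IsSmoothEnd E F (fun x => φ x + χ x) := fun σ x h => (hφ σ x h).add (hχ σ x h)

theorem IsSmoothEnd.sub {φ χ : EndSection V} (hφ : IsSmoothEnd E F φ) (hχ : IsSmoothEnd E F χ) :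
    IsSmoothEnd E F (fun x => φ x - χ x) := fun σ x h => (hφ σ x h).sub (hχ σ x h)

theorem IsSmoothEnd.mul {φ χ : EndSection V} (hφ : IsSmoothEnd E F φ) (hχ : IsSmoothEnd E F χ) :
    IsSmoothEnd E F (fun x => φ x * χ x) := fun σ x h => hφ _ x (hχ σ x h)

theorem isSmoothEnd_algebraMap (c : ℂ) :
    IsSmoothEnd E F (fun x => algebraMap ℂ (Module.End ℂ (V x)) c) :=
  fun _ _ h => h.smul contMDiffAt_const

section

variable [FiniteDimensional ℂ F]

theorem trace_eq_sum_coord (φ : EndSection V) {p y : X} (hy : y ∈ dom F V p)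
    {ι : Type*} [Fintype ι] (b : Module.Basis ι ℂ F) :
    LinearMap.trace ℂ (V y) (φ y) =
      ∑ i, b.repr (coord F p y (φ y (frame V p y (b i)))) i := by
  classical
  rw [← LinearMap.trace_conj' (φ y) (coordEquiv hy), LinearMap.trace_eq_matrix_trace ℂ b,
    Matrix.trace]
  refine Finset.sum_congr rfl fun i _ => ?_
  rw [Matrix.diag_apply, LinearMap.toMatrix_apply]
  rfl

theorem IsSmoothEnd.contMDiff_trace {φ : EndSection V} (hφ : IsSmoothEnd E F φ) :
    ContMDiff 𝓘(ℝ, E) 𝓘(ℝ, ℂ) ∞ (fun x => LinearMap.trace ℂ (V x) (φ x)) := by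
  intro x
  set b := Module.finBasis ℂ F
  have h : ContMDiffAt 𝓘(ℝ, E) 𝓘(ℝ, ℂ) ∞
      (fun y => ∑ i, b.repr (coord F x y (φ y (frame V x y (b i)))) i) x := by
    refine contMDiffAt_finsetSum fun i _ => ?_
    have h1 := (smoothSectionAt_iff (mem_dom x)).1
      (hφ _ x (smoothSectionAt_frame (E := E) (V := V) (mem_dom x) (b i)))
    let ℓ : F →L[ℝ] ℂ := (LinearMap.toContinuousLinearMap (b.coord i)).restrictScalars ℝ
    exact ℓ.contDiff.contMDiff.contMDiffAt.comp x h1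
  refine h.congr_of_eventuallyEq ?_
  filter_upwards [dom_mem_nhds (F := F) (V := V) (mem_dom x)] with y hy
  exact trace_eq_sum_coord φ hy b

end

end Sections

/-! ### Connections in local trivializations -/

section Connection

variable {E : Type*} [NormedAddCommGroup E] [NormedSpace ℂ E]
  {X : Type*} [TopologicalSpace X] [ChartedSpace E X] [IsManifold 𝓘(ℂ, E) ω X]
  {F : Type*} [NormedAddCommGroup F] [NormedSpace ℂ F]
  {V : X → Type*} [TopologicalSpace (TotalSpace F V)] [∀ x, AddCommGroup (V x)]
  [∀ x, Module ℂ (V x)] [∀ x, TopologicalSpace (V x)] [FiberBundle F V]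
  [∀ x, IsTopologicalAddGroup (V x)] [∀ x, ContinuousSMul ℂ (V x)]
  [VectorBundle ℂ F V]
  {D : CovariantDerivative 𝓘(ℝ, E) F V}

theorem SmoothSectionAt.mdifferentiableAt {σ : Π x : X, V x} {x : X}
    (h : SmoothSectionAt E F σ x) :
    MDifferentiableAt 𝓘(ℝ, E) (𝓘(ℝ, E).prod 𝓘(ℝ, F)) (fun y => TotalSpace.mk' F y (σ y)) x :=
  ContMDiffAt.mdifferentiableAt h (by simp)

theorem nabla_congr {σ τ : Π x : X, V x} {x : X} (hσ : SmoothSectionAt E F σ x)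
    (hτ : SmoothSectionAt E F τ x) (h : ∀ᶠ y in nhds x, σ y = τ y) (v : RT E x) :
    D σ x v = D τ x v := by
  rw [D.isCovariantDerivativeOnUniv.congr_of_eventuallyEq hσ.mdifferentiableAt
    hτ.mdifferentiableAt Filter.univ_mem h]

theorem nabla_add {σ τ : Π x : X, V x} {x : X} (hσ : SmoothSectionAt E F σ x)
    (hτ : SmoothSectionAt E F τ x) (v : RT E x) :
    D (fun y => σ y + τ y) x v = D σ x v + D τ x v := by
  have := D.isCovariantDerivativeOnUniv.add hσ.mdifferentiableAt hτ.mdifferentiableAt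
  exact congrArg (fun L => L v) this

theorem nabla_real_smul {f : X → ℝ} {σ : Π x : X, V x} {x : X}
    (hf : ContMDiffAt 𝓘(ℝ, E) 𝓘(ℝ, ℝ) ∞ f x) (hσ : SmoothSectionAt E F σ x) (v : RT E x) :
    D (fun y => f y • σ y) x v = f x • D σ x v + mvfderiv 𝓘(ℝ, E) f x v • σ x := by
  have := D.isCovariantDerivativeOnUniv.leibniz hσ.mdifferentiableAt
    (hf.mdifferentiableAt (by simp))
  exact congrArg (fun L => L v) this

variable [ContMDiffVectorBundle ∞ F V 𝓘(ℝ, E)]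

/-- The covariant derivative is a real one; complex constants are handled by splitting `c` into real
and imaginary parts and using linearity over `i`. -/
theorem nabla_smul (hD : IsComplexConnection D) {σ : Π x : X, V x} {x : X}
    (hσ : SmoothSectionAt E F σ x) (c : ℂ) (v : RT E x) :
    D (fun y => c • σ y) x v = c • D σ x v := by
  have h1 : ∀ (r : ℝ) {τ : Π x : X, V x}, SmoothSectionAt E F τ x →
      D (fun y => r • τ y) x v = r • D τ x v := by
    intro r τ hτ
    have := nabla_real_smul (D := D) (f := fun _ => r) contMDiffAt_const hτ v
    rwa [mvfderiv_const, zero_apply, zero_smul, add_zero] at this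
  have hI : SmoothSectionAt E F (fun y => Complex.I • σ y) x := hσ.smul contMDiffAt_const
  have hr : ∀ (r : ℝ) {τ : Π x : X, V x}, SmoothSectionAt E F τ x →
      SmoothSectionAt E F (fun y => r • τ y) x := fun r τ hτ =>
    hτ.smul (f := fun _ => (r : ℂ)) contMDiffAt_const
  have h2 := nabla_add (D := D) (hr c.re hσ) (hr c.im hI) v
  have e : ∀ (y : X) (u : V y), c • u = c.re • u + c.im • Complex.I • u := by
    intro y u
    nth_rewrite 1 [← Complex.re_add_im c]
    rw [add_smul, mul_smul]
    rfl
  have h3 : (fun y => c • σ y) = fun y => c.re • σ y + c.im • Complex.I • σ y :=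
    funext fun y => e y _
  rw [h3, h2, h1 _ hσ, h1 _ hI, hD.linear σ x v hσ.mdifferentiableAt, e]

theorem nabla_sum {ι : Type*} (s : Finset ι) {σ : ι → Π x : X, V x} {x : X}
    (hσ : ∀ i ∈ s, SmoothSectionAt E F (σ i) x) (v : RT E x) :
    D (fun y => ∑ i ∈ s, σ i y) x v = ∑ i ∈ s, D (σ i) x v := by
  classical
  induction s using Finset.induction_on with
  | empty =>
    simp only [Finset.sum_empty]
    exact congrArg (fun L : Π x, TangentSpace 𝓘(ℝ, E) x →L[ℝ] V x => L x v) D.zero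
  | insert i s hi ih =>
    simp only [Finset.sum_insert hi]
    rw [nabla_add (hσ i (Finset.mem_insert_self i s))
      (SmoothSectionAt.sum fun j hj => hσ j (Finset.mem_insert_of_mem hj)),
      ih fun j hj => hσ j (Finset.mem_insert_of_mem hj)]

variable (D) in
/-- The connection form in the preferred trivialization at `p`. -/
def connectionForm (p x : X) (v : RT E x) (w : F) : F :=
  coord F p x (D (fun y => frame V p y w) x v)

theorem connectionForm_add {p x : X} (hx : x ∈ dom F V p) (v : RT E x) (w w' : F) :
    connectionForm D p x v (w + w') = connectionForm D p x v w + connectionForm D p x v w' := by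
  simp only [connectionForm, map_add]
  rw [nabla_add (smoothSectionAt_frame hx w) (smoothSectionAt_frame hx w'), map_add]

theorem connectionForm_smul (hD : IsComplexConnection D) {p x : X} (hx : x ∈ dom F V p)
    (v : RT E x) (c : ℂ) (w : F) :
    connectionForm D p x v (c • w) = c • connectionForm D p x v w := by
  simp only [connectionForm, map_smul]
  rw [nabla_smul hD (smoothSectionAt_frame hx w), map_smul]

variable [FiniteDimensional ℂ F]

/-- In a local trivialization, a connection is `d` plus the connection form. -/
theorem coord_nabla (hD : IsComplexConnection D) {p x : X} (hx : x ∈ dom F V p)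
    {τ : Π x : X, V x} (hτ : SmoothSectionAt E F τ x) (v : RT E x) :
    coord F p x (D τ x v) =
      mvfderiv 𝓘(ℝ, E) (fun y => coord F p y (τ y)) x v +
        connectionForm D p x v (coord F p x (τ x)) := by
  -- A real basis is taken because the Leibniz rule of `D` is stated for real functions.
  set b := Module.finBasis ℝ F
  have hτ' := (smoothSectionAt_iff hx).1 hτ
  let ℓ : ∀ i, F →L[ℝ] ℝ := fun i => LinearMap.toContinuousLinearMap (b.coord i)
  have hℓ : ∀ i, ContMDiffAt 𝓘(ℝ, E) 𝓘(ℝ, ℝ) ∞ (fun y => ℓ i (coord F p y (τ y))) x := fun i =>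
    (ℓ i).contDiff.contMDiff.contMDiffAt.comp x hτ'
  have hdℓ : ∀ i, mvfderiv 𝓘(ℝ, E) (fun y => ℓ i (coord F p y (τ y))) x v =
      ℓ i (mvfderiv 𝓘(ℝ, E) (fun y => coord F p y (τ y)) x v) := by
    intro i
    have h1 := (ℓ i).hasMFDerivAt (x := coord F p x (τ x))
    have h2 := (hτ'.mdifferentiableAt (by simp)).hasMFDerivAt
    have h3 := (h1.comp x h2).mfderiv
    exact congrArg (fun L => L v) h3
  have hfr : ∀ i, SmoothSectionAt E F
      (fun y => ℓ i (coord F p y (τ y)) • frame V p y (b i)) x := by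
    intro i
    have : ContMDiffAt 𝓘(ℝ, E) 𝓘(ℝ, ℂ) ∞
        (fun y => ((ℓ i (coord F p y (τ y)) : ℝ) : ℂ)) x :=
      Complex.ofRealCLM.contDiff.contMDiff.contMDiffAt.comp x (hℓ i)
    exact (smoothSectionAt_frame hx (b i)).smul this
  have hsum : ∀ᶠ y in nhds x, τ y = ∑ i, ℓ i (coord F p y (τ y)) • frame V p y (b i) := by
    filter_upwards [dom_mem_nhds hx] with y hy
    have h1 : coord F p y (τ y) = ∑ i, ℓ i (coord F p y (τ y)) • b i :=
      (b.sum_repr _).symm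
    conv_lhs => rw [← frame_coord hy (τ y), h1, map_sum]
    exact Finset.sum_congr rfl fun i _ =>
      (frame V p y).map_smul_of_tower (ℓ i (coord F p y (τ y))) (b i)
  have hω : connectionForm D p x v (coord F p x (τ x)) =
      ∑ i, ℓ i (coord F p x (τ x)) • connectionForm D p x v (b i) := by
    let Ω : F →ₗ[ℂ] F := ⟨⟨connectionForm D p x v, connectionForm_add hx v⟩,
      connectionForm_smul hD hx v⟩
    change Ω (coord F p x (τ x)) = ∑ i, ℓ i (coord F p x (τ x)) • Ω (b i)
    conv_lhs => rw [← b.sum_repr (coord F p x (τ x)), map_sum]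
    exact Finset.sum_congr rfl fun i _ => Ω.map_smul_of_tower _ (b i)
  rw [nabla_congr hτ (SmoothSectionAt.sum fun i _ => hfr i) hsum v,
    nabla_sum Finset.univ (fun i _ => hfr i) v, map_sum, hω]
  have hterm : ∀ i, coord F p x
      (D (fun y => ℓ i (coord F p y (τ y)) • frame V p y (b i)) x v) =
        ℓ i (mvfderiv 𝓘(ℝ, E) (fun y => coord F p y (τ y)) x v) • b i +
        ℓ i (coord F p x (τ x)) • connectionForm D p x v (b i) := by
    intro i
    rw [nabla_real_smul (hℓ i) (smoothSectionAt_frame hx (b i)) v, map_add, hdℓ, add_comm]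
    congr 1
    · exact ((coord F p x).map_smul_of_tower _ _).trans (by rw [coord_frame hx])
    · exact (coord F p x).map_smul_of_tower _ _
  simp only [hterm, Finset.sum_add_distrib]
  congr 1
  exact b.sum_repr _

end Connection

/-! ### Functions with zero derivative -/

section Constant

variable {E : Type*} [NormedAddCommGroup E] [NormedSpace ℝ E]
  {X : Type*} [TopologicalSpace X] [ChartedSpace E X] [IsManifold 𝓘(ℝ, E) 1 X]
  {G : Type*} [NormedAddCommGroup G] [NormedSpace ℝ G]

/-- A differentiable function with zero derivative on a connected manifold is constant. -/
theorem eq_of_mvfderiv_eq_zero [PreconnectedSpace X] {f : X → G}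
    (hf : MDifferentiable 𝓘(ℝ, E) 𝓘(ℝ, G) f) (h : ∀ x, mvfderiv 𝓘(ℝ, E) f x = 0) (x y : X) :
    f x = f y := by
  refine IsLocallyConstant.apply_eq_of_preconnectedSpace ?_ x y
  rw [IsLocallyConstant.iff_eventually_eq]
  intro p
  set e := chartAt E p
  obtain ⟨r, hr, hball⟩ := Metric.isOpen_iff.1 e.open_target (e p)
    (e.map_source (mem_chart_source E p))
  have hd : ∀ z ∈ Metric.ball (e p) r, HasFDerivAt (f ∘ e.symm) (0 : E →L[ℝ] G) z := by
    intro z hz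
    have h1 : MDifferentiableAt 𝓘(ℝ, E) 𝓘(ℝ, E) e.symm z :=
      mdifferentiableAt_atlas_symm (chart_mem_atlas E p) (hball hz)
    have h2 := (hf (e.symm z)).hasMFDerivAt.comp z h1.hasMFDerivAt
    have h3 : mfderiv 𝓘(ℝ, E) 𝓘(ℝ, G) f (e.symm z) = 0 := h (e.symm z)
    rw [h3] at h2
    have h4 := h2.hasFDerivAt
    refine h4.congr_fderiv ?_
    ext w
    rfl
  have hc : ∀ z ∈ Metric.ball (e p) r, (f ∘ e.symm) z = (f ∘ e.symm) (e p) := by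
    intro z hz
    refine Metric.isOpen_ball.is_const_of_fderiv_eq_zero (𝕜 := ℝ)
      (convex_ball (e p) r).isPreconnected
      (fun w hw => (hd w hw).differentiableAt.differentiableWithinAt)
      (fun w hw => (hd w hw).fderiv) hz (Metric.mem_ball_self hr)
  have hcont : ContinuousAt e p := e.continuousAt (mem_chart_source E p)
  filter_upwards [hcont (Metric.ball_mem_nhds (e p) hr),
    e.open_source.mem_nhds (mem_chart_source E p)] with q hq hq'
  have := hc (e q) hq
  simpa [e.left_inv hq', e.left_inv (mem_chart_source E p)] using this

theorem mvfderiv_congr {f g : X → G} {x : X} (h : f =ᶠ[nhds x] g) :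
    mvfderiv 𝓘(ℝ, E) f x = mvfderiv 𝓘(ℝ, E) g x := by
  have h1 := h.mfderiv_eq (I := 𝓘(ℝ, E)) (I' := 𝓘(ℝ, G))
  exact h1

theorem mvfderiv_finsetSum_apply {ι : Type*} {s : Finset ι} {f : ι → X → G} {x : X}
    (hf : ∀ i ∈ s, MDifferentiableAt 𝓘(ℝ, E) 𝓘(ℝ, G) (f i) x) (v : TangentSpace 𝓘(ℝ, E) x) :
    mvfderiv 𝓘(ℝ, E) (fun y => ∑ i ∈ s, f i y) x v = ∑ i ∈ s, mvfderiv 𝓘(ℝ, E) (f i) x v := by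
  classical
  have key : MDifferentiableAt 𝓘(ℝ, E) 𝓘(ℝ, G) (fun y => ∑ i ∈ s, f i y) x ∧
      mvfderiv 𝓘(ℝ, E) (fun y => ∑ i ∈ s, f i y) x v = ∑ i ∈ s, mvfderiv 𝓘(ℝ, E) (f i) x v := by
    induction s using Finset.induction_on with
    | empty =>
      refine ⟨by simpa using mdifferentiableAt_const, ?_⟩
      simp only [Finset.sum_empty]
      rw [mvfderiv_const, zero_apply]
    | insert i s hi ih =>
      obtain ⟨h1, h2⟩ := ih fun j hj => hf j (Finset.mem_insert_of_mem hj)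
      have h3 := hf i (Finset.mem_insert_self i s)
      simp only [Finset.sum_insert hi]
      refine ⟨h3.add h1, ?_⟩
      rw [mvfderiv_fun_add h3 h1, add_apply, h2]
  exact key.2

end Constant

/-! ### Parallel endomorphisms -/

section Parallel

variable {E : Type*} [NormedAddCommGroup E] [NormedSpace ℂ E]
  {X : Type*} [TopologicalSpace X] [ChartedSpace E X] [IsManifold 𝓘(ℂ, E) ω X]
  {F : Type*} [NormedAddCommGroup F] [NormedSpace ℂ F]
  {V : X → Type*} [TopologicalSpace (TotalSpace F V)] [∀ x, AddCommGroup (V x)]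
  [∀ x, Module ℂ (V x)] [∀ x, TopologicalSpace (V x)] [FiberBundle F V]
  [∀ x, IsTopologicalAddGroup (V x)] [∀ x, ContinuousSMul ℂ (V x)]
  [VectorBundle ℂ F V] [ContMDiffVectorBundle ∞ F V 𝓘(ℝ, E)]

/-- A smooth endomorphism of `V` which commutes with the connection `D`. -/
structure IsParallel (D : CovariantDerivative 𝓘(ℝ, E) F V) (φ : EndSection V) : Prop where
  smooth : IsSmoothEnd E F φ
  comm : ∀ (σ : Π x : X, V x) (x : X) (v : RT E x), SmoothSectionAt E F σ x →
    D (fun y => φ y (σ y)) x v = φ x (D σ x v)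

variable {D : CovariantDerivative 𝓘(ℝ, E) F V}

theorem IsParallel.mul {φ χ : EndSection V} (hφ : IsParallel D φ) (hχ : IsParallel D χ) :
    IsParallel D (fun x => φ x * χ x) where
  smooth := hφ.smooth.mul hχ.smooth
  comm σ x v h := by
    rw [Module.End.mul_apply, ← hχ.comm σ x v h]
    exact hφ.comm _ x v (hχ.smooth σ x h)

theorem IsParallel.add {φ χ : EndSection V} (hφ : IsParallel D φ) (hχ : IsParallel D χ) :
    IsParallel D (fun x => φ x + χ x) where
  smooth := hφ.smooth.add hχ.smooth
  comm σ x v h := by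
    rw [LinearMap.add_apply, ← hφ.comm σ x v h, ← hχ.comm σ x v h]
    exact nabla_add (hφ.smooth σ x h) (hχ.smooth σ x h) v

theorem isParallel_algebraMap (hD : IsComplexConnection D) (c : ℂ) :
    IsParallel D (fun x => algebraMap ℂ (Module.End ℂ (V x)) c) where
  smooth := isSmoothEnd_algebraMap c
  comm _ _ v h := nabla_smul hD h c v

theorem IsParallel.aeval (hD : IsComplexConnection D) {φ : EndSection V} (hφ : IsParallel D φ)
    (q : Polynomial ℂ) : IsParallel D (fun x => Polynomial.aeval (φ x) q) := by
  induction q using Polynomial.induction_on' with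
  | add p q hp hq => simpa only [map_add] using hp.add hq
  | monomial n a =>
    simp only [Polynomial.aeval_monomial]
    refine (isParallel_algebraMap hD a).mul ?_
    induction n with
    | zero => simpa using isParallel_algebraMap hD 1
    | succ n ih => simpa only [pow_succ] using ih.mul hφ

variable [FiniteDimensional ℂ F]

/-- In a trivialization with connection form `Ω`, being parallel means `dΦ = ΦΩ - ΩΦ`, and a
commutator has trace zero. -/
theorem IsParallel.mvfderiv_trace (hD : IsComplexConnection D) {φ : EndSection V}
    (hφ : IsParallel D φ) (x : X) :
    mvfderiv 𝓘(ℝ, E) (fun x => LinearMap.trace ℂ (V x) (φ x)) x = 0 := by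
  ext v
  set b := Module.finBasis ℂ F
  let ℓ : ∀ i, F →L[ℝ] ℂ := fun i =>
    (LinearMap.toContinuousLinearMap (b.coord i)).restrictScalars ℝ
  have hx : x ∈ dom F V x := mem_dom x
  have hτ : ∀ i, SmoothSectionAt E F (fun y => φ y (frame V x y (b i))) x := fun i =>
    hφ.smooth _ x (smoothSectionAt_frame hx (b i))
  have hcτ := fun i => (smoothSectionAt_iff hx).1 (hτ i)
  let Ω : F →ₗ[ℂ] F := ⟨⟨connectionForm D x x v, connectionForm_add hx v⟩,
    connectionForm_smul hD hx v⟩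
  let Φ : F →ₗ[ℂ] F := coord F x x ∘ₗ φ x ∘ₗ frame V x x
  have hd : ∀ i, mvfderiv 𝓘(ℝ, E) (fun y => coord F x y (φ y (frame V x y (b i)))) x v =
      Φ (Ω (b i)) - Ω (Φ (b i)) := by
    intro i
    rw [eq_sub_iff_add_eq]
    refine (coord_nabla hD hx (hτ i) v).symm.trans ?_
    rw [hφ.comm _ x v (smoothSectionAt_frame hx (b i))]
    change _ = coord F x x (φ x (frame V x x (coord F x x _)))
    rw [frame_coord hx]
  have hℓ : ∀ i, MDifferentiableAt 𝓘(ℝ, E) 𝓘(ℝ, ℂ)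
      (fun y => ℓ i (coord F x y (φ y (frame V x y (b i))))) x := fun i =>
    ((ℓ i).contDiff.contMDiff.contMDiffAt.comp x (hcτ i)).mdifferentiableAt (by simp)
  have hdℓ : ∀ i, mvfderiv 𝓘(ℝ, E) (fun y => ℓ i (coord F x y (φ y (frame V x y (b i))))) x v =
      ℓ i (mvfderiv 𝓘(ℝ, E) (fun y => coord F x y (φ y (frame V x y (b i)))) x v) := fun i =>
    congrArg (fun L => L v) ((ℓ i).hasMFDerivAt.comp x
      ((hcτ i).mdifferentiableAt (by simp)).hasMFDerivAt).mfderiv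
  have htr : (fun y => LinearMap.trace ℂ (V y) (φ y)) =ᶠ[nhds x]
      fun y => ∑ i, ℓ i (coord F x y (φ y (frame V x y (b i)))) := by
    filter_upwards [dom_mem_nhds hx] with y hy
    exact trace_eq_sum_coord φ hy b
  have h1 : mvfderiv 𝓘(ℝ, E) (fun x => LinearMap.trace ℂ (V x) (φ x)) x v =
      ∑ i, ℓ i (mvfderiv 𝓘(ℝ, E) (fun y => coord F x y (φ y (frame V x y (b i)))) x v) := by
    have h0 : mvfderiv 𝓘(ℝ, E) (fun x => LinearMap.trace ℂ (V x) (φ x)) x v =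
        mvfderiv 𝓘(ℝ, E) (fun y => ∑ i, ℓ i (coord F x y (φ y (frame V x y (b i))))) x v :=
      congrArg (fun L => L v) (mvfderiv_congr htr)
    rw [h0, mvfderiv_finsetSum_apply (fun i _ => hℓ i)]
    exact Finset.sum_congr rfl fun i _ => hdℓ i
  have htrace : ∀ T : F →ₗ[ℂ] F, LinearMap.trace ℂ F T = ∑ i, ℓ i (T (b i)) := by
    intro T
    rw [LinearMap.trace_eq_matrix_trace ℂ b, Matrix.trace]
    exact Finset.sum_congr rfl fun i _ => by rw [Matrix.diag_apply, LinearMap.toMatrix_apply]; rfl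
  rw [h1]
  simp only [hd, map_sub, Finset.sum_sub_distrib]
  have h2 := htrace (Φ ∘ₗ Ω)
  have h3 := htrace (Ω ∘ₗ Φ)
  have h4 := LinearMap.trace_comp_comm' Φ Ω
  rw [h2, h3] at h4
  exact sub_eq_zero.2 h4.symm

/-- The trace of a parallel endomorphism is constant. -/
theorem IsParallel.trace_eq [PreconnectedSpace X] (hD : IsComplexConnection D) {φ : EndSection V}
    (hφ : IsParallel D φ) (x y : X) :
    LinearMap.trace ℂ (V x) (φ x) = LinearMap.trace ℂ (V y) (φ y) :=
  haveI : IsManifold 𝓘(ℝ, E) 1 X := .of_le (n := ω) (by simp)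
  eq_of_mvfderiv_eq_zero (f := fun x => LinearMap.trace ℂ (V x) (φ x))
    (hφ.smooth.contMDiff_trace.mdifferentiable (by simp)) (hφ.mvfderiv_trace hD) x y

end Parallel

/-! ### Self-adjoint endomorphisms of a fibre -/

section Fibre

variable {E : Type*} [NormedAddCommGroup E] [NormedSpace ℂ E]
  {X : Type*} [TopologicalSpace X] [ChartedSpace E X]
  {F : Type*} [NormedAddCommGroup F] [NormedSpace ℂ F]
  {V : X → Type*} [TopologicalSpace (TotalSpace F V)] [∀ x, AddCommGroup (V x)]
  [∀ x, Module ℂ (V x)] [∀ x, TopologicalSpace (V x)] [FiberBundle F V]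
  [FiniteDimensional ℂ F] [VectorBundle ℂ F V]
  (H : HermitianMetric E F V)

/-- There are unitary bases of the fibres; traces are computed in such a basis. -/
theorem HermitianMetric.exists_basis_trace (x : X) :
    ∃ (n : ℕ) (e : Module.Basis (Fin n) ℂ (V x)), ∀ A : Module.End ℂ (V x),
      LinearMap.trace ℂ (V x) A = ∑ i, H.form x (A (e i)) (e i) := by
  let := H.core x
  let : NormedAddCommGroup (V x) := InnerProductSpace.Core.toNormedAddCommGroup (𝕜 := ℂ)
  let : InnerProductSpace ℂ (V x) := InnerProductSpace.ofCore (H.core x).toCore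
  have : FiniteDimensional ℂ (V x) := finiteDimensional_fiber F x
  refine ⟨_, (stdOrthonormalBasis ℂ (V x)).toBasis, fun A => ?_⟩
  rw [LinearMap.trace_eq_sum_inner A (stdOrthonormalBasis ℂ (V x))]
  simp only [OrthonormalBasis.coe_toBasis]
  rfl

theorem HermitianMetric.squarefree_minpoly (x : X) (A : Module.End ℂ (V x))
    (hA : ∀ u w, H.form x (A u) w = H.form x u (A w)) : Squarefree (minpoly ℂ A) := by
  let := H.core x
  let : NormedAddCommGroup (V x) := InnerProductSpace.Core.toNormedAddCommGroup (𝕜 := ℂ)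
  let : InnerProductSpace ℂ (V x) := InnerProductSpace.ofCore (H.core x).toCore
  have : FiniteDimensional ℂ (V x) := finiteDimensional_fiber F x
  -- The arguments are exchanged because `core` reverses the two variables of `H.form`.
  have hs : LinearMap.IsSymmetric A := fun u w => (hA w u).symm
  exact (Module.End.isFinitelySemisimple_iff_isSemisimple.1
    hs.isFinitelySemisimple).minpoly_squarefree

theorem HermitianMetric.form_aeval (x : X) (A : Module.End ℂ (V x))
    (hA : ∀ u w, H.form x (A u) w = H.form x u (A w)) (p : Polynomial ℂ) (u w : V x) :
    H.form x (Polynomial.aeval A p u) w =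
      H.form x u (Polynomial.aeval A (p.map (starRingEnd ℂ)) w) := by
  induction p using Polynomial.induction_on' generalizing u w with
  | add p q hp hq => simp [hp, hq]
  | monomial n a =>
    have hpow : ∀ u w, H.form x ((A ^ n) u) w = H.form x u ((A ^ n) w) := by
      induction n with
      | zero => simp
      | succ n ih =>
        intro u w
        rw [pow_succ, Module.End.mul_apply, ih, hA, ← Module.End.mul_apply, ← pow_succ']
        rw [pow_succ]
    simp [Polynomial.aeval_monomial, hpow, Module.algebraMap_end_apply]

/-- Conjugating the coefficients of `p` gives the adjoint of `p(A)`, so the trace in the hypothesis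
is the squared Hilbert–Schmidt norm of `p(A)`. Thus `p(A) = 0` can be read off from a trace, and
traces of parallel endomorphisms are constant. -/
theorem HermitianMetric.aeval_eq_zero (x : X) (A : Module.End ℂ (V x))
    (hA : ∀ u w, H.form x (A u) w = H.form x u (A w)) (p : Polynomial ℂ)
    (h : LinearMap.trace ℂ (V x) (Polynomial.aeval A (p.map (starRingEnd ℂ) * p)) = 0) :
    Polynomial.aeval A p = 0 := by
  obtain ⟨n, e, he⟩ := H.exists_basis_trace x
  have h1 : ∀ i, H.form x (Polynomial.aeval A (p.map (starRingEnd ℂ) * p) (e i)) (e i) =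
      H.form x (Polynomial.aeval A p (e i)) (Polynomial.aeval A p (e i)) := by
    intro i
    rw [map_mul, Module.End.mul_apply, H.form_aeval x A hA, Polynomial.map_map]
    congr 3
    simp
  have hpos : ∀ u, 0 ≤ (H.form x u u).re := fun u => by
    by_cases hu : u = 0
    · simp [hu]
    · exact (H.pos x u hu).le
  rw [he] at h
  simp only [h1] at h
  have h2 := congrArg Complex.re h
  rw [Complex.re_sum, Complex.zero_re, Finset.sum_eq_zero_iff_of_nonneg fun i _ => hpos _] at h2
  refine e.ext fun i => ?_
  by_contra hne
  exact (H.pos x _ hne).ne' (h2 i (Finset.mem_univ i))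

end Fibre

/-! ### Parallel self-adjoint endomorphisms of a simple bundle -/

section Simple

variable {E : Type*} [NormedAddCommGroup E] [NormedSpace ℂ E]
  {X : Type*} [TopologicalSpace X] [ChartedSpace E X] [IsManifold 𝓘(ℂ, E) ω X]
  {F : Type*} [NormedAddCommGroup F] [NormedSpace ℂ F] [FiniteDimensional ℂ F]
  {V : X → Type*} [TopologicalSpace (TotalSpace F V)] [∀ x, AddCommGroup (V x)]
  [∀ x, Module ℂ (V x)] [∀ x, TopologicalSpace (V x)] [FiberBundle F V]
  [∀ x, IsTopologicalAddGroup (V x)] [∀ x, ContinuousSMul ℂ (V x)]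
  [VectorBundle ℂ F V] [ContMDiffVectorBundle ∞ F V 𝓘(ℝ, E)]
  {D : CovariantDerivative 𝓘(ℝ, E) F V}

/-- The images of a smooth family of projections of constant rank form a subbundle. -/
theorem isSubbundle_of_isProj {q : EndSection V} (hq : IsSmoothEnd E F q)
    {S : Π x : X, Submodule ℂ (V x)} (hS : ∀ x, LinearMap.IsProj (S x) (q x))
    (hr : ∀ x y, Module.finrank ℂ (S x) = Module.finrank ℂ (S y)) : IsSubbundle F E S := by
  intro x
  have hfin : ∀ y, FiniteDimensional ℂ (V y) := fun y => finiteDimensional_fiber F y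
  set k := Module.finrank ℂ (S x)
  set u := Module.finBasis ℂ (S x)
  -- A basis of `S x` is extended with constant coordinates and projected to `S`; it stays
  -- independent near `x`, and constancy of the rank makes it span.
  let s : Fin k → Π y : X, V y := fun i y => q y (frame V x y (coord F x x (u i : V x)))
  have hsm : ∀ y ∈ dom F V x, ∀ i, SmoothSectionAt E F (s i) y := fun y hy i =>
    hq _ y (smoothSectionAt_frame hy _)
  have hcont : ContinuousOn (fun y => fun i => coord F x y (s i y)) (dom F V x) := fun y hy =>
    (continuousAt_pi.2 fun i =>
      ((smoothSectionAt_iff hy).1 (hsm y hy i)).continuousAt).continuousWithinAt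
  have hopen := hcont.isOpen_inter_preimage (trivializationAt F V x).open_baseSet
    (isOpen_setOfPred_linearIndependent (𝕜 := ℂ) (ι := Fin k) (E := F))
  refine ⟨_, hopen, ⟨mem_dom x, ?_⟩, k, s, ?_⟩
  · have hx : ∀ i, s i x = u i := fun i => by
      simp only [s]
      rw [frame_coord (mem_dom x)]
      exact (hS x).map_id _ (u i).2
    have h1 : LinearIndependent ℂ fun i => (u i : V x) :=
      u.linearIndependent.map' (S x).subtype (Submodule.ker_subtype _)
    have h2 := h1.map' (coordEquiv (F := F) (mem_dom x)).toLinearMap (LinearEquiv.ker _)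
    simp only [Set.mem_preimage, Set.mem_ofPred_eq, hx]
    exact h2
  · rintro y ⟨hy, hli⟩
    have hli' : LinearIndependent ℂ fun i => s i y :=
      LinearIndependent.of_comp (coord F x y) hli
    refine ⟨hsm y hy, hli', ?_⟩
    refine Submodule.eq_of_le_of_finrank_eq ?_ ?_
    · rw [Submodule.span_le]
      rintro _ ⟨i, rfl⟩
      exact (hS y).map_mem _
    · rw [finrank_span_eq_card hli', Fintype.card_fin]
      exact hr x y

/-- A parallel self-adjoint endomorphism of a simple bundle is a multiple of the identity. -/
theorem IsSimple.eq_smul_of_isParallel [ConnectedSpace X] (hD : IsComplexConnection D)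
    (hs : IsSimple F (toNabla D)) (H : HermitianMetric E F V) {h : EndSection V}
    (hp : IsParallel D h) (hsa : ∀ x u w, H.form x (h x u) w = H.form x u (h x w)) :
    ∃ μ : ℂ, ∀ x u, h x u = μ • u := by
  obtain ⟨x₀⟩ := (inferInstance : Nonempty X)
  have hfin : ∀ y, FiniteDimensional ℂ (V y) := fun y => finiteDimensional_fiber F y
  rcases subsingleton_or_nontrivial F with hF | hF
  -- In rank zero there is no eigenvalue to choose, and any scalar works.
  · refine ⟨0, fun x u => (coordEquiv (F := F) (mem_dom x)).injective (Subsingleton.elim _ _)⟩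
  have hV : Nontrivial (V x₀) := (coordEquiv (F := F) (V := V) (mem_dom x₀)).toEquiv.nontrivial
  obtain ⟨μ, hμ⟩ := Module.End.exists_eigenvalue (h x₀)
  -- A polynomial relation at `x₀` propagates to all of `X`, since the squared norm of `p(h)` is the
  -- trace of a parallel endomorphism.
  have hzero : ∀ (p : Polynomial ℂ), Polynomial.aeval (h x₀) p = 0 →
      ∀ x, Polynomial.aeval (h x) p = 0 := by
    intro p h0 x
    refine H.aeval_eq_zero x (h x) (hsa x) p ?_
    rw [(hp.aeval hD (p.map (starRingEnd ℂ) * p)).trace_eq hD x x₀, map_mul, h0, mul_zero, map_zero]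
  obtain ⟨r, hr⟩ := Polynomial.dvd_iff_isRoot.2 (Module.End.isRoot_of_hasEigenvalue hμ)
  -- Self-adjointness makes the minimal polynomial squarefree, so `μ` is a simple root.
  have hcop : IsCoprime (Polynomial.X - Polynomial.C μ) r := by
    have hsq := H.squarefree_minpoly x₀ (h x₀) (hsa x₀)
    rw [hr] at hsq
    exact (squarefree_mul_iff.1 hsq).1.isCoprime
  obtain ⟨a, b, hab⟩ := hcop
  have hm : ∀ x, Polynomial.aeval (h x) ((Polynomial.X - Polynomial.C μ) * r) = 0 :=
    hzero _ (by rw [← hr]; exact minpoly.aeval ℂ (h x₀))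
  -- By the Bézout identity `a (X - μ) + b r = 1`, the polynomial `b r` in `h` is the identity on
  -- the `μ`-eigenspace; its image lies there because `(X - μ) r` annihilates `h`.
  let q : EndSection V := fun x => Polynomial.aeval (h x) (b * r)
  have hqp : IsParallel D q := hp.aeval hD (b * r)
  let S : Π x : X, Submodule ℂ (V x) := fun x => Module.End.eigenspace (h x) μ
  have hX : ∀ x u, Polynomial.aeval (h x) (Polynomial.X - Polynomial.C μ) u = h x u - μ • u := by
    intro x u
    simp [Module.algebraMap_end_apply]
  have hS : ∀ x, LinearMap.IsProj (S x) (q x) := by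
    intro x
    refine ⟨fun u => ?_, fun u hu => ?_⟩
    · rw [Module.End.mem_eigenspace_iff, ← sub_eq_zero, ← hX, ← Module.End.mul_apply, ← map_mul]
      have : (Polynomial.X - Polynomial.C μ) * (b * r) =
          b * ((Polynomial.X - Polynomial.C μ) * r) := by ring
      rw [this, map_mul, hm, mul_zero, LinearMap.zero_apply]
    · rw [Module.End.mem_eigenspace_iff, ← sub_eq_zero, ← hX] at hu
      have := congrArg (fun p => Polynomial.aeval (h x) p u) hab
      simp only [map_add, map_mul, LinearMap.add_apply, Module.End.mul_apply, hu, map_zero, zero_add,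
        map_one, Module.End.one_apply] at this
      simpa only [q, map_mul, Module.End.mul_apply] using this
  -- The rank of a projection is its trace, and `q` is parallel.
  have hrank : ∀ x y, Module.finrank ℂ (S x) = Module.finrank ℂ (S y) := by
    intro x y
    have := hqp.trace_eq hD x y
    rw [(hS x).trace, (hS y).trace] at this
    exact_mod_cast this
  have hinv : IsInvariant F (toNabla D) S := by
    intro σ x v hσ hev
    rw [Module.End.mem_eigenspace_iff]
    have h1 := hp.comm σ x v hσ
    have h2 : D (fun y => h y (σ y)) x v = D (fun y => μ • σ y) x v :=
      nabla_congr (hp.smooth σ x hσ) (hσ.smul contMDiffAt_const)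
        (hev.mono fun y hy => Module.End.mem_eigenspace_iff.1 hy) v
    rw [nabla_smul hD hσ, h1] at h2
    exact h2
  rcases hs S (isSubbundle_of_isProj hqp.smooth hS hrank) hinv with h0 | h1
  · exact absurd (h0 x₀) hμ
  · refine ⟨μ, fun x u => Module.End.mem_eigenspace_iff.1 ?_⟩
    rw [show Module.End.eigenspace (h x) μ = ⊤ from h1 x]
    trivial

end Simple

/-! ### Smoothness of the inverse matrix -/

section MatrixInverse

instance contMDiffMul_complex : ContMDiffMul 𝓘(ℝ, ℂ) ∞ ℂ where
  contMDiff_mul := by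
    rw [← modelWithCornersSelf_prod, chartedSpaceSelf_prod]
    exact (contDiff_mul (𝕜 := ℝ) (𝔸 := ℂ)).contMDiff

variable {E : Type*} [NormedAddCommGroup E] [NormedSpace ℝ E]
  {X : Type*} [TopologicalSpace X] [ChartedSpace E X]
  {ι : Type*} [Fintype ι] [DecidableEq ι] {G : X → Matrix ι ι ℂ} {x : X}

theorem contMDiffAt_matrix_det
    (hG : ∀ i j, ContMDiffAt 𝓘(ℝ, E) 𝓘(ℝ, ℂ) ∞ (fun y => G y i j) x) :
    ContMDiffAt 𝓘(ℝ, E) 𝓘(ℝ, ℂ) ∞ (fun y => (G y).det) x := by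
  simp only [Matrix.det_apply']
  exact contMDiffAt_finsetSum fun s _ =>
    contMDiffAt_const.mul (contMDiffAt_finsetProd fun i _ => hG _ _)

theorem contMDiffAt_matrix_inv
    (hG : ∀ i j, ContMDiffAt 𝓘(ℝ, E) 𝓘(ℝ, ℂ) ∞ (fun y => G y i j) x) (h : (G x).det ≠ 0)
    (i j : ι) : ContMDiffAt 𝓘(ℝ, E) 𝓘(ℝ, ℂ) ∞ (fun y => (G y)⁻¹ i j) x := by
  simp only [Matrix.inv_def, Matrix.smul_apply, Matrix.adjugate_apply, smul_eq_mul,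
    Ring.inverse_eq_inv']
  refine ContMDiffAt.mul ?_ (contMDiffAt_matrix_det fun k l => ?_)
  · exact (contDiffAt_inv ℝ h).contMDiffAt.comp x (contMDiffAt_matrix_det hG)
  · by_cases hk : k = j
    · subst hk
      simp only [Matrix.updateRow_self]
      exact contMDiffAt_const
    · simp only [Matrix.updateRow_ne hk]
      exact hG k l

end MatrixInverse

/-! ### The endomorphism relating two Hermitian metrics -/

section Fibre

variable {E : Type*} [NormedAddCommGroup E] [NormedSpace ℂ E]
  {X : Type*} [TopologicalSpace X] [ChartedSpace E X]
  {F : Type*} [NormedAddCommGroup F] [NormedSpace ℂ F]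
  {V : X → Type*} [TopologicalSpace (TotalSpace F V)] [∀ x, AddCommGroup (V x)]
  [∀ x, Module ℂ (V x)] [∀ x, TopologicalSpace (V x)] [FiberBundle F V]

namespace HermitianMetric

variable (H : HermitianMetric E F V)

theorem ext_form {x : X} {u u' : V x} (h : ∀ w, H.form x u w = H.form x u' w) : u = u' := by
  by_contra hne
  have h1 := H.pos x (u - u') (sub_ne_zero.2 hne)
  have h2 : H.form x (u - u') (u - u') = 0 := by
    rw [(H.form x).map_sub, LinearMap.sub_apply, h, sub_self]
  rw [h2] at h1
  exact lt_irrefl _ h1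

variable {ι : Type*} [Fintype ι] [DecidableEq ι]

/-- The Gram matrix of a Hermitian metric. -/
def gramMatrix {x : X} (e : ι → V x) : Matrix ι ι ℂ := Matrix.of fun i j => H.form x (e i) (e j)

/-- A left null vector of the Gram matrix would give a nonzero isotropic vector. -/
theorem det_gramMatrix_ne_zero {x : X} {e : ι → V x} (he : LinearIndependent ℂ e) :
    (H.gramMatrix e).det ≠ 0 := by
  intro h0
  obtain ⟨c, hc, h⟩ := Matrix.exists_vecMul_eq_zero_iff.2 h0
  have h1 : ∀ j, H.form x (∑ i, c i • e i) (e j) = 0 := fun j => by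
    simpa [Matrix.vecMul, dotProduct, gramMatrix] using congrFun h j
  have h2 : H.form x (∑ i, c i • e i) (∑ i, c i • e i) = 0 := by
    rw [map_sum]
    simp only [map_smulₛₗ, h1, smul_zero, Finset.sum_const_zero]
  have h3 : ∑ i, c i • e i = 0 := by
    by_contra hne
    have := H.pos x _ hne
    rw [h2] at this
    exact lt_irrefl _ this
  exact hc (funext (Fintype.linearIndependent_iff.1 he c h3))

/-- The endomorphism relating two metrics, computed in a basis. -/
theorem form_sum_inv_gramMatrix (H' : HermitianMetric E F V) {x : X} (e : Module.Basis ι ℂ (V x))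
    (u w : V x) :
    H.form x (∑ i, (∑ j, H'.form x u (e j) * (H.gramMatrix e)⁻¹ j i) • e i) w =
      H'.form x u w := by
  have hinv := Matrix.nonsing_inv_mul (H.gramMatrix e)
    (H.det_gramMatrix_ne_zero e.linearIndependent).isUnit
  have h1 : ∀ k, H.form x (∑ i, (∑ j, H'.form x u (e j) * (H.gramMatrix e)⁻¹ j i) • e i) (e k) =
      H'.form x u (e k) := by
    intro k
    simp only [map_sum, map_smul, LinearMap.sum_apply, LinearMap.smul_apply, smul_eq_mul,
      Finset.sum_mul]
    rw [Finset.sum_comm]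
    have h2 : ∀ j, ∑ i, H'.form x u (e j) * (H.gramMatrix e)⁻¹ j i * H.form x (e i) (e k) =
        H'.form x u (e j) * (1 : Matrix ι ι ℂ) j k := by
      intro j
      rw [← hinv, Matrix.mul_apply, Finset.mul_sum]
      exact Finset.sum_congr rfl fun i _ => mul_assoc _ _ _
    simp [h2, Matrix.one_apply]
  rw [← e.sum_repr w]
  rw [map_sum (H.form x _), map_sum (H'.form x u)]
  simp only [map_smulₛₗ, h1]

variable [FiniteDimensional ℂ F] [VectorBundle ℂ F V]

theorem exists_end (H' : HermitianMetric E F V) (x : X) :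
    ∃ T : Module.End ℂ (V x), ∀ u w, H.form x (T u) w = H'.form x u w := by
  have : FiniteDimensional ℂ (V x) := finiteDimensional_fiber F x
  choose T hT using fun u => (⟨_, H.form_sum_inv_gramMatrix H' (Module.finBasis ℂ (V x)) u⟩ :
    ∃ z, ∀ w, H.form x z w = H'.form x u w)
  refine ⟨⟨⟨T, fun u v => H.ext_form fun w => ?_⟩, fun c u => H.ext_form fun w => ?_⟩, hT⟩
  · simp [hT]
  · simp [hT]

/-- The endomorphism `h` with `H'(u, w) = H(h u, w)`. -/
def rel (H' : HermitianMetric E F V) : EndSection V := fun x => (H.exists_end H' x).choose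

theorem form_rel (H' : HermitianMetric E F V) (x : X) (u w : V x) :
    H.form x (H.rel H' x u) w = H'.form x u w := (H.exists_end H' x).choose_spec u w

theorem rel_selfAdjoint (H' : HermitianMetric E F V) (x : X) (u w : V x) :
    H.form x (H.rel H' x u) w = H.form x u (H.rel H' x w) := by
  rw [form_rel, H'.symm, H.symm x u, form_rel]

/-- Fibrewise, `rel` comes from a choice, but it is unique; in a local frame it is therefore given
by the inverse Gram matrix formula, which has smooth coefficients. -/
theorem isSmoothEnd_rel [ContMDiffVectorBundle ∞ F V 𝓘(ℝ, E)] (H' : HermitianMetric E F V) :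
    IsSmoothEnd E F (H.rel H') := by
  intro σ x hσ
  set b := Module.finBasis ℂ F
  let G : X → Matrix _ _ ℂ := fun y => H.gramMatrix fun i => frame V x y (b i)
  have hx : x ∈ dom F V x := mem_dom x
  have hfr := fun i => smoothSectionAt_frame (E := E) (V := V) hx (b i)
  let e : ∀ y, y ∈ dom F V x → Module.Basis _ ℂ (V y) := fun y hy => b.map (coordEquiv hy).symm
  have he : ∀ y (hy : y ∈ dom F V x), ⇑(e y hy) = fun i => frame V x y (b i) := fun y hy => by
    funext i
    exact b.map_apply _ i
  have hG : ∀ i j, ContMDiffAt 𝓘(ℝ, E) 𝓘(ℝ, ℂ) ∞ (fun y => G y i j) x := fun i j =>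
    H.smooth _ _ x (hfr i) (hfr j)
  have hdet : (G x).det ≠ 0 := by
    have := H.det_gramMatrix_ne_zero (e x hx).linearIndependent
    rwa [he] at this
  have hsm : SmoothSectionAt E F (fun y => ∑ i, (∑ j, H'.form y (σ y) (frame V x y (b j)) *
      (G y)⁻¹ j i) • frame V x y (b i)) x := by
    refine SmoothSectionAt.sum fun i _ => SmoothSectionAt.smul ?_ (hfr i)
    exact contMDiffAt_finsetSum fun j _ =>
      (H'.smooth _ _ x hσ (hfr j)).mul (contMDiffAt_matrix_inv hG hdet j i)
  refine hsm.congr ?_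
  filter_upwards [dom_mem_nhds hx] with y hy
  refine H.ext_form fun w => ?_
  rw [form_rel, ← H.form_sum_inv_gramMatrix H' (e y hy) (σ y) w]
  simp only [he, G]

end HermitianMetric

end Fibre

/-! ### The covariant derivative of the relative endomorphism -/

section Derivative

variable {E : Type*} [NormedAddCommGroup E] [NormedSpace ℂ E]
  {X : Type*} [TopologicalSpace X] [ChartedSpace E X] [IsManifold 𝓘(ℂ, E) ω X]
  {F : Type*} [NormedAddCommGroup F] [NormedSpace ℂ F] [FiniteDimensional ℂ F]
  {V : X → Type*} [TopologicalSpace (TotalSpace F V)] [∀ x, AddCommGroup (V x)]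
  [∀ x, Module ℂ (V x)] [∀ x, TopologicalSpace (V x)] [FiberBundle F V]
  [VectorBundle ℂ F V] [ContMDiffVectorBundle ∞ F V 𝓘(ℝ, E)]
  {D : Nabla E V} {H₁ H₂ : HermitianMetric E F V} {ψ₁ ψ₂ : EndForm E V}

/-- The covariant derivative of the endomorphism relating two metrics. -/
theorem nabla_rel (h₁ : IsSelfAdjointPart D H₁ ψ₁) (h₂ : IsSelfAdjointPart D H₂ ψ₂)
    {σ : Π x : X, V x} {x : X} (hσ : SmoothSectionAt E F σ x) (v : RT E x) :
    D (fun y => H₁.rel H₂ y (σ y)) x v = H₁.rel H₂ x (D σ x v) +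
      (2 : ℂ) • (ψ₁ x v (H₁.rel H₂ x (σ x)) - H₁.rel H₂ x (ψ₂ x v (σ x))) := by
  refine H₁.ext_form fun w => ?_
  obtain ⟨τ, hτ, rfl⟩ := exists_smoothSectionAt E F x w
  -- `H₁(h σ, τ)` and `H₂(σ, τ)` are the same function; its derivative is computed with each unitary
  -- connection, and the two results are equated.
  have e₁ := h₁.unitary _ τ x v (H₁.isSmoothEnd_rel H₂ σ x hσ) hτ
  have e₂ := h₂.unitary σ τ x v hσ hτ
  simp only [H₁.form_rel, subForm, map_sub, LinearMap.sub_apply] at e₁ e₂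
  have s₁ := h₁.selfAdjoint x v (H₁.rel H₂ x (σ x)) (τ x)
  rw [H₁.form_rel] at s₁
  have s₂ := h₂.selfAdjoint x v (σ x) (τ x)
  simp only [map_add, map_smul, map_sub, LinearMap.add_apply, LinearMap.smul_apply,
    LinearMap.sub_apply, H₁.form_rel, smul_eq_mul]
  linear_combination e₂ - e₁ - s₁ + s₂

/-- The covariant derivative of the relative endomorphism for the unitary part of `D`. -/
theorem isEndDeriv_rel_left (h₁ : IsSelfAdjointPart D H₁ ψ₁) (h₂ : IsSelfAdjointPart D H₂ ψ₂) :
    IsEndDeriv F (subForm D ψ₁) (H₁.rel H₂) (fun x =>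
      (LinearMap.mulRight ℝ (H₁.rel H₂ x)).comp (ψ₁ x) +
        (LinearMap.mulLeft ℝ (H₁.rel H₂ x)).comp (ψ₁ x) -
        (2 : ℝ) • (LinearMap.mulLeft ℝ (H₁.rel H₂ x)).comp (ψ₂ x)) := by
  intro σ x v hσ
  simp only [subForm]
  rw [nabla_rel h₁ h₂ hσ]
  simp only [LinearMap.sub_apply, LinearMap.add_apply, LinearMap.comp_apply,
    LinearMap.mulRight_apply, LinearMap.mulLeft_apply, Module.End.mul_apply, map_sub,
    LinearMap.smul_apply]
  module

/-- Passing from `D` to `D - ψ₂` subtracts the commutator `ψ₂ h - h ψ₂` from `2(ψ₁ h - h ψ₂)`. -/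
theorem isEndDeriv_rel_right (h₁ : IsSelfAdjointPart D H₁ ψ₁) (h₂ : IsSelfAdjointPart D H₂ ψ₂) :
    IsEndDeriv F (subForm D ψ₂) (H₁.rel H₂) (fun x =>
      (2 : ℝ) • (LinearMap.mulRight ℝ (H₁.rel H₂ x)).comp (ψ₁ x) -
        (LinearMap.mulLeft ℝ (H₁.rel H₂ x)).comp (ψ₂ x) -
        (LinearMap.mulRight ℝ (H₁.rel H₂ x)).comp (ψ₂ x)) := by
  intro σ x v hσ
  simp only [subForm]
  rw [nabla_rel h₁ h₂ hσ]
  simp only [LinearMap.sub_apply, LinearMap.comp_apply,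
    LinearMap.mulRight_apply, LinearMap.mulLeft_apply, Module.End.mul_apply, map_sub,
    LinearMap.smul_apply]
  module

end Derivative

/-! ### Coordinate frames of the tangent bundle -/

section TangentFrames

variable {E : Type*} [NormedAddCommGroup E] [NormedSpace ℂ E]
  {X : Type*} [TopologicalSpace X] [ChartedSpace E X] [IsManifold 𝓘(ℂ, E) ω X]

theorem isManifoldReal_one : IsManifold 𝓘(ℝ, E) 1 X := .of_le (n := ω) (by simp)

/-- The coordinate vector field with value `w` in the chart at `p`. -/
def coordField (p y : X) (w : E) : RT E y :=
  haveI : IsManifold 𝓘(ℝ, E) 1 X := isManifoldReal_one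
  (trivializationAt E (TangentSpace 𝓘(ℝ, E) : X → Type _) p).symmL ℝ y w

/-- The tangent space at `y` is a copy of `E` through the preferred chart at `y`, so a vector of the
chart at `p` enters it by the derivative of the transition map. -/
theorem coordField_eq_fderiv {p y : X} (hy : y ∈ (chartAt E p).source) (w : E) :
    coordField p y w =
      fderiv ℝ ((chartAt E y) ∘ (chartAt E p).symm) (chartAt E p y) w := by
  have : IsManifold 𝓘(ℝ, E) 1 X := isManifoldReal_one
  unfold coordField
  rw [TangentBundle.symmL_trivializationAt_eq_core hy, tangentBundleCore_coordChange]
  simp only [mfld_simps]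
  rw [fderivWithin_univ]
  rfl

/-- Transition maps are holomorphic, so their derivatives commute with `i`. -/
theorem J_coordField {p y : X} (hy : y ∈ (chartAt E p).source) (w : E) :
    J E y (coordField p y w) = coordField p y (Complex.I • w) := by
  have h := (contDiffGroupoid ω 𝓘(ℂ, E)).compatible (H := E) (M := X) (chart_mem_atlas E p)
    (chart_mem_atlas E y)
  rw [contDiffGroupoid, mem_groupoid_of_pregroupoid] at h
  have h1 : ContDiffOn ℂ ω ((chartAt E y) ∘ (chartAt E p).symm)
      ((chartAt E p).symm.trans (chartAt E y)).source := by
    have h0 : ContDiffOn ℂ ω ((chartAt E y) ∘ (chartAt E p).symm)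
      (((chartAt E p).symm.trans (chartAt E y)).source ∩ Set.range (fun z : E => z)) := h.1
    exact h0.mono fun z hz => ⟨hz, z, rfl⟩
  have hmem : chartAt E p y ∈ ((chartAt E p).symm.trans (chartAt E y)).source := by
    simp [hy]
  have hd : DifferentiableAt ℂ ((chartAt E y) ∘ (chartAt E p).symm) (chartAt E p y) :=
    (h1.contDiffAt (((chartAt E p).symm.trans
      (chartAt E y)).open_source.mem_nhds hmem)).differentiableAt (by simp)
  rw [coordField_eq_fderiv hy, coordField_eq_fderiv hy, hd.fderiv_restrictScalars ℝ]
  exact ((fderiv ℂ ((chartAt E y) ∘ (chartAt E p).symm) (chartAt E p y)).map_smul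
    Complex.I w).symm

theorem contMDiffOn_coordField (p : X) (w : E) :
    ContMDiffOn 𝓘(ℝ, E) (𝓘(ℝ, E).prod 𝓘(ℝ, E)) ∞
      (fun y => TotalSpace.mk' E (E := (TangentSpace 𝓘(ℝ, E) : X → Type _)) y (coordField p y w))
      (chartAt E p).source := by
  have : IsManifold 𝓘(ℝ, E) 1 X := isManifoldReal_one
  have : IsManifold 𝓘(ℝ, E) (∞ + 1) X := .of_le (n := ω) (by simp)
  have h2 := (Trivialization.contMDiffOn_section_baseSet_iff (n := ∞) (𝕜 := ℝ) (IB := 𝓘(ℝ, E))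
    (trivializationAt E (TangentSpace 𝓘(ℝ, E) : X → Type _) p)
    (s := fun y => coordField p y w)).2
  refine h2 ((contMDiffOn_const (c := w)).congr fun y hy => ?_)
  have := (trivializationAt E (TangentSpace 𝓘(ℝ, E) : X → Type _) p).apply_mk_symm hy w
  unfold coordField
  rw [Trivialization.symmL_apply _ hy]
  exact congrArg Prod.snd this

/-- This identifies the frame used in `chartDensity` with the coordinate fields. -/
theorem mfderiv_chart_symm {p : X} {z : E} (hz : z ∈ (chartAt E p).target) (w : E) :
    mfderiv 𝓘(ℝ, E) 𝓘(ℝ, E) (chartAt E p).symm z w = coordField p ((chartAt E p).symm z) w := by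
  have : IsManifold 𝓘(ℝ, E) 1 X := isManifoldReal_one
  unfold coordField
  have h := TangentBundle.symmL_trivializationAt (𝕜 := ℝ) (I := 𝓘(ℝ, E))
    ((chartAt E p).map_target hz)
  rw [h]
  simp only [mfld_simps, mfderivWithin_univ]
  rw [(chartAt E p).right_inv hz]
  rfl

/-- The coordinate vector fields of a basis of the model space form a basis. -/
def coordBasis {ι : Type*} {p y : X} (hy : y ∈ (chartAt E p).source) (b : Module.Basis ι ℝ E) :
    Module.Basis ι ℝ (RT E y) :=
  haveI : IsManifold 𝓘(ℝ, E) 1 X := isManifoldReal_one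
  b.map ((trivializationAt E (TangentSpace 𝓘(ℝ, E) : X → Type _) p).continuousLinearEquivAt
    ℝ y hy).symm.toLinearEquiv

theorem coordBasis_apply {ι : Type*} {p y : X} (hy : y ∈ (chartAt E p).source)
    (b : Module.Basis ι ℝ E) (i : ι) : coordBasis hy b i = coordField p y (b i) := by
  have : IsManifold 𝓘(ℝ, E) 1 X := isManifoldReal_one
  unfold coordBasis coordField
  rw [Module.Basis.map_apply]
  exact (congrFun (Trivialization.symm_continuousLinearEquivAt_eq
    (trivializationAt E (TangentSpace 𝓘(ℝ, E) : X → Type _) p) (R := ℝ) hy) (b i))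

/-- Near any point, a coordinate vector field agrees with a globally smooth vector field. -/
theorem exists_isSmoothField [FiniteDimensional ℂ E] [T2Space X] (p : X) (w : E) :
    ∃ Y : Π x : X, RT E x, IsSmoothField Y ∧ ∀ᶠ y in nhds p, Y y = coordField p y w := by
  have : IsManifold 𝓘(ℝ, E) 1 X := isManifoldReal_one
  have : IsManifold 𝓘(ℝ, E) ∞ X := .of_le (n := ω) (by simp)
  -- `IsSmoothEndForm` tests only globally smooth fields, hence the cutoff.
  obtain ⟨f⟩ := (inferInstance : Nonempty (SmoothBumpFunction 𝓘(ℝ, E) p))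
  refine ⟨fun y => f y • coordField p y w, ?_, ?_⟩
  · exact ContMDiffOn.smul_section_of_tsupport (ψ := f) (s := fun y => coordField p y w)
      f.contMDiff.contMDiffOn (chartAt E p).open_source f.tsupport_subset_chartAt_source
      (contMDiffOn_coordField p w)
  · filter_upwards [f.eventuallyEq_one] with y hy
    rw [hy, Pi.one_apply, one_smul]

namespace KahlerForm

variable (κ : KahlerForm E X)

/-- In `g(u, v) = ω(u, Jv)` the operator `J` is absorbed into the constant vector, replacing `w'` by
`i w'`; only smoothness of `ω` is then needed. -/
theorem continuousOn_metric_coordField (p : X) (w w' : E) :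
    ContinuousOn (fun y => κ.metricₗ y (coordField p y w) (coordField p y w'))
      (chartAt E p).source := by
  intro y hy
  have h1 := (contMDiffOn_coordField p w).contMDiffAt ((chartAt E p).open_source.mem_nhds hy)
  have h2 := (contMDiffOn_coordField p (Complex.I • w')).contMDiffAt
    ((chartAt E p).open_source.mem_nhds hy)
  have : IsManifold 𝓘(ℝ, E) 1 X := isManifoldReal_one
  have h3 : ContMDiffAt 𝓘(ℝ, E) (𝓘(ℝ, E).prod 𝓘(ℝ, ℝ)) ∞
      (fun y => TotalSpace.mk' ℝ (E := fun _ : X => ℝ) y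
        (κ.form y (coordField p y w) (coordField p y (Complex.I • w')))) y :=
    (κ.smooth y).clm_bundle_apply₂ h1 h2
  have h4 := ((contMDiffAt_totalSpace).1 h3).2.continuousAt
  refine ContinuousAt.continuousWithinAt (h4.congr ?_)
  filter_upwards [(chartAt E p).open_source.mem_nhds hy] with z hz
  change κ.form z _ _ = κ.form z _ (J E z _)
  rw [J_coordField hz]

end KahlerForm

end TangentFrames

/-! ### The volume measure is finite and positive on open sets -/

section Volume

variable {E : Type*} [NormedAddCommGroup E] [NormedSpace ℂ E] [FiniteDimensional ℂ E]
  {X : Type*} [TopologicalSpace X] [ChartedSpace E X] [IsManifold 𝓘(ℂ, E) ω X]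

namespace KahlerForm

variable (κ : KahlerForm E X)

/-- The coefficients of the metric in the coordinate frame of the chart at `p`. -/
def coordGram (p y : X) :
    Matrix (Fin (Module.finrank ℝ E)) (Fin (Module.finrank ℝ E)) ℝ :=
  Matrix.of fun i j => κ.metricₗ y (coordField p y (Module.finBasis ℝ E i))
    (coordField p y (Module.finBasis ℝ E j))

theorem continuousOn_coordGram (p : X) : ContinuousOn (κ.coordGram p) (chartAt E p).source :=
  continuousOn_pi.2 fun _ => continuousOn_pi.2 fun _ => κ.continuousOn_metric_coordField p _ _

theorem coordGram_eq {p y : X} (hy : y ∈ (chartAt E p).source) :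
    κ.coordGram p y = Matrix.of fun i j => κ.metricₗ y (coordBasis hy (Module.finBasis ℝ E) i)
      (coordBasis hy (Module.finBasis ℝ E) j) := by
  simp only [coordBasis_apply]
  rfl

theorem det_coordGram_pos {p y : X} (hy : y ∈ (chartAt E p).source) :
    0 < (κ.coordGram p y).det := by
  rw [coordGram_eq κ hy]
  exact (gramMatrix_posDef _ (κ.metric_symm y) (κ.metric_pos y) _).det_pos

theorem chartDensity_eq {p : X} {z : E} (hz : z ∈ (chartAt E p).target) :
    κ.chartDensity p z = Real.sqrt (κ.coordGram p ((chartAt E p).symm z)).det := by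
  unfold chartDensity
  simp only [mfderiv_chart_symm hz]
  rfl

theorem continuousOn_chartDensity (p : X) :
    ContinuousOn (κ.chartDensity p) (chartAt E p).target := by
  have h1 : ContinuousOn (fun z => κ.coordGram p ((chartAt E p).symm z)) (chartAt E p).target :=
    (κ.continuousOn_coordGram p).comp (chartAt E p).continuousOn_symm
      fun z hz => (chartAt E p).map_target hz
  have h2 := Real.continuous_sqrt.comp_continuousOn
    ((continuous_id.matrix_det).comp_continuousOn h1)
  exact h2.congr fun z hz => κ.chartDensity_eq hz

theorem chartDensity_pos {p : X} {z : E} (hz : z ∈ (chartAt E p).target) :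
    0 < κ.chartDensity p z := by
  rw [chartDensity_eq κ hz]
  exact Real.sqrt_pos.2 (κ.det_coordGram_pos ((chartAt E p).map_target hz))

/-- The metric trace in a coordinate frame. -/
theorem gTrace_eq_coord {W : Type*} [AddCommGroup W] [Module ℝ W] {p y : X}
    (hy : y ∈ (chartAt E p).source) (B : RT E y →ₗ[ℝ] RT E y →ₗ[ℝ] W) :
    κ.gTrace y (fun u v => B u v) = ∑ i, ∑ j, (κ.coordGram p y)⁻¹ i j •
      B (coordField p y (Module.finBasis ℝ E i)) (coordField p y (Module.finBasis ℝ E j)) := by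
  rw [κ.gTrace_eq_basisTrace y B (coordBasis hy (Module.finBasis ℝ E))]
  unfold basisTrace
  rw [← coordGram_eq]
  simp only [coordBasis_apply]

theorem continuousAt_inv_coordGram (p : X) (i j : Fin (Module.finrank ℝ E)) :
    ContinuousAt (fun y => (κ.coordGram p y)⁻¹ i j) p := by
  have hp : p ∈ (chartAt E p).source := mem_chart_source E p
  have h := (κ.continuousOn_coordGram p).continuousAt ((chartAt E p).open_source.mem_nhds hp)
  have h1 : ContinuousAt (fun y => (κ.coordGram p y).det) p :=
    (continuous_id.matrix_det).continuousAt.comp h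
  have h2 : ContinuousAt (fun y => (κ.coordGram p y).adjugate i j) p :=
    ((continuous_id.matrix_adjugate).matrix_elem i j).continuousAt.comp h
  simp only [Matrix.inv_def, Matrix.smul_apply, smul_eq_mul, Ring.inverse_eq_inv']
  exact (h1.inv₀ (κ.det_coordGram_pos hp).ne').mul h2

variable [CompactSpace X] [T2Space X]

variable (E X) in
theorem tsupport_partition_subset (p : X) :
    tsupport (partition E X p) ⊆ (chartAt E p).source :=
  (SmoothPartitionOfUnity.exists_isSubordinate_chartAt_source 𝓘(ℝ, E) X).choose_spec p

variable [MeasurableSpace E] [BorelSpace E] [MeasurableSpace X] [BorelSpace X]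

/-- The density of the volume in the chart at `p`, weighted by the partition of unity. -/
def localDensity (p : X) (z : E) : ENNReal :=
  ENNReal.ofReal (partition E X p ((chartAt E p).symm z) * κ.chartDensity p z)

/-- The part of the volume in the chart at `p`. -/
def localVolume (p : X) : Measure X :=
  Measure.map (chartAt E p).symm
    (((Module.finBasis ℝ E).addHaar.restrict (chartAt E p).target).withDensity (κ.localDensity p))

theorem volume_eq_sum : κ.volume = Measure.sum κ.localVolume := rfl

theorem continuousOn_localDensity (p : X) :
    ContinuousOn (κ.localDensity p) (chartAt E p).target :=
  ENNReal.continuous_ofReal.comp_continuousOn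
    (((partition E X p).contMDiff.continuous.comp_continuousOn
      (chartAt E p).continuousOn_symm).mul (κ.continuousOn_chartDensity p))

/-- Within the chart target, the density vanishes off the image of the support of the cutoff, which
is compact, and is bounded on it by continuity. -/
theorem isFiniteMeasure_localVolume (p : X) : IsFiniteMeasure (κ.localVolume p) := by
  set e := chartAt E p
  set K : Set E := e '' tsupport (partition E X p)
  have hK : IsCompact K := (isClosed_tsupport _).isCompact.image_of_continuousOn
    (e.continuousOn.mono (tsupport_partition_subset E X p))
  have hKt : K ⊆ e.target := by
    rintro _ ⟨y, hy, rfl⟩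
    exact e.map_source (tsupport_partition_subset E X p hy)
  obtain ⟨C, hC⟩ := hK.exists_bound_of_continuousOn (f := fun z =>
    partition E X p (e.symm z) * κ.chartDensity p z)
    ((((partition E X p).contMDiff.continuous.comp_continuousOn
      e.continuousOn_symm).mul (κ.continuousOn_chartDensity p)).mono hKt)
  have hle : ∀ z ∈ e.target, κ.localDensity p z ≤ K.indicator (fun _ => ENNReal.ofReal C) z := by
    intro z hz
    by_cases hzK : z ∈ K
    · rw [Set.indicator_of_mem hzK]
      exact ENNReal.ofReal_le_ofReal ((le_abs_self _).trans (hC z hzK))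
    · have : partition E X p (e.symm z) = 0 := by
        by_contra hne
        exact hzK ⟨e.symm z, subset_tsupport _ hne, e.right_inv hz⟩
      simp [localDensity, e, this]
  have hfin : ∫⁻ z, κ.localDensity p z ∂((Module.finBasis ℝ E).addHaar.restrict e.target) ≠ ⊤ := by
    refine ne_top_of_le_ne_top ?_ (setLIntegral_mono' e.open_target.measurableSet hle)
    refine ne_top_of_le_ne_top ?_ (setLIntegral_le_lintegral _ _)
    rw [lintegral_indicator_const hK.measurableSet]
    exact ENNReal.mul_ne_top ENNReal.ofReal_ne_top hK.measure_lt_top.ne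
  have := isFiniteMeasure_withDensity hfin
  unfold localVolume
  infer_instance

theorem localVolume_eq_zero {p : X} (h : ∀ y, partition E X p y = 0) : κ.localVolume p = 0 := by
  have : κ.localDensity p = 0 := by
    funext z
    simp [localDensity, h]
  simp [localVolume, this]

theorem isFiniteMeasure_volume : IsFiniteMeasure κ.volume := by
  have hfin : {p | (Function.support (partition E X p)).Nonempty}.Finite :=
    (partition E X).locallyFinite.finite_nonempty_of_compact
  refine ⟨?_⟩
  rw [volume_eq_sum, Measure.sum_apply _ MeasurableSet.univ,
    tsum_eq_sum (s := hfin.toFinset) fun p hp => ?_]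
  · exact ENNReal.sum_lt_top.2 fun p _ => (κ.isFiniteMeasure_localVolume p).measure_univ_lt_top
  · rw [κ.localVolume_eq_zero, Measure.coe_zero, Pi.zero_apply]
    intro y
    by_contra hne
    exact hp (hfin.mem_toFinset.2 ⟨y, hne⟩)

/-- Some function of the partition is positive at a given point of `U`; the corresponding local
density is positive on a nonempty open subset of the chart. -/
theorem isOpenPosMeasure_volume : κ.volume.IsOpenPosMeasure := by
  refine ⟨fun U hU hne h0 => ?_⟩
  obtain ⟨x, hx⟩ := hne
  obtain ⟨p, hp⟩ := (partition E X).exists_pos_of_mem (Set.mem_univ x)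
  set e := chartAt E p
  have hxs : x ∈ e.source := tsupport_partition_subset E X p (subset_tsupport _ hp.ne')
  have h1 : κ.localVolume p U = 0 := by
    rw [volume_eq_sum, Measure.sum_apply _ hU.measurableSet] at h0
    exact (ENNReal.tsum_eq_zero.1 h0) p
  set μ := (Module.finBasis ℝ E).addHaar.restrict e.target
  have hmeas : AEMeasurable e.symm (μ.withDensity (κ.localDensity p)) :=
    (e.continuousOn_symm.aemeasurable e.open_target.measurableSet).mono_ac
      (withDensity_absolutelyContinuous _ _)
  have h2 : μ.withDensity (κ.localDensity p) (e.symm ⁻¹' U) = 0 := by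
    rw [← Measure.map_apply_of_aemeasurable hmeas hU.measurableSet]
    exact h1
  rw [withDensity_apply_eq_zero'
    ((κ.continuousOn_localDensity p).aemeasurable e.open_target.measurableSet)] at h2
  set W : Set E := e.target ∩ e.symm ⁻¹' (U ∩ {y | 0 < partition E X p y})
  have hW : IsOpen W := e.symm.isOpen_inter_preimage
    (hU.inter (isOpen_lt continuous_const (partition E X p).contMDiff.continuous))
  have hWne : W.Nonempty :=
    ⟨e x, e.map_source hxs, by simpa [e.left_inv hxs] using ⟨hx, hp⟩⟩
  have h3 : μ W = 0 := by
    refine measure_mono_null ?_ h2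
    rintro z ⟨hz, hzU, hz0⟩
    refine ⟨?_, hzU⟩
    exact (ENNReal.ofReal_pos.2 (mul_pos hz0 (κ.chartDensity_pos hz))).ne'
  rw [Measure.restrict_apply hW.measurableSet, Set.inter_eq_left.2 Set.inter_subset_left] at h3
  exact (hW.measure_pos _ hWne).ne' h3

end KahlerForm

end Volume

/-! ### Continuity of the integrands -/

section Pairing

variable {E : Type*} [NormedAddCommGroup E] [NormedSpace ℂ E] [FiniteDimensional ℂ E]
  {X : Type*} [TopologicalSpace X] [ChartedSpace E X] [IsManifold 𝓘(ℂ, E) ω X]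
  {F : Type*} [NormedAddCommGroup F] [NormedSpace ℂ F] [FiniteDimensional ℂ F]
  {V : X → Type*} [TopologicalSpace (TotalSpace F V)] [∀ x, AddCommGroup (V x)]
  [∀ x, Module ℂ (V x)] [∀ x, TopologicalSpace (V x)] [FiberBundle F V]
  [VectorBundle ℂ F V] [ContMDiffVectorBundle ∞ F V 𝓘(ℝ, E)]

/-- The bilinear form `(u, v) ↦ tr (A(u) B(v))`. -/
def pairing (A B : EndForm E V) (x : X) : RT E x →ₗ[ℝ] RT E x →ₗ[ℝ] ℂ :=
  LinearMap.mk₂ ℝ (fun u v => LinearMap.trace ℂ (V x) (A x u * B x v))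
    (fun u v w => by rw [map_add, add_mul, map_add])
    (fun c u v => by
      rw [map_smul, smul_mul_assoc]
      exact LinearMap.map_smul_of_tower _ c _)
    (fun u v w => by rw [map_add, mul_add, map_add])
    (fun c u v => by
      rw [map_smul, mul_smul_comm]
      exact LinearMap.map_smul_of_tower _ c _)

theorem pairing_apply (A B : EndForm E V) (x : X) (u v : RT E x) :
    pairing A B x u v = LinearMap.trace ℂ (V x) (A x u * B x v) := rfl

/-- The basis in `gTrace` at `x` belongs to the preferred chart at `x`, which need not vary
continuously. Near `p` the trace is rewritten in the frame of the single chart at `p`. -/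
theorem continuous_gTrace_pairing [T2Space X] (κ : KahlerForm E X) {A B : EndForm E V}
    (hA : IsSmoothEndForm F A) (hB : IsSmoothEndForm F B) :
    Continuous fun x => κ.gTrace x (fun u v => pairing A B x u v) := by
  refine continuous_iff_continuousAt.2 fun p => ?_
  choose Y hY hYe using fun w => exists_isSmoothField (E := E) p w
  set b := Module.finBasis ℝ E
  have h1 : ContinuousAt (fun y => ∑ i, ∑ j, (κ.coordGram p y)⁻¹ i j •
      LinearMap.trace ℂ (V y) (A y (Y (b i) y) * B y (Y (b j) y))) p := by
    refine tendsto_finsetSum _ fun i _ => tendsto_finsetSum _ fun j _ => ?_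
    exact (κ.continuousAt_inv_coordGram p i j).smul
      ((hA _ (hY (b i))).mul (hB _ (hY (b j)))).contMDiff_trace.continuous.continuousAt
  refine h1.congr ?_
  filter_upwards [(chartAt E p).open_source.mem_nhds (mem_chart_source E p),
    Filter.eventually_all.2 fun i => hYe (b i)] with y hy hYy
  rw [κ.gTrace_eq_coord hy]
  simp only [hYy]
  rfl

end Pairing

/-! ### Two harmonic metrics have the same self-adjoint part -/

section Uniqueness

variable {E : Type*} [NormedAddCommGroup E] [NormedSpace ℂ E] [FiniteDimensional ℂ E]
  {X : Type*} [TopologicalSpace X] [ChartedSpace E X] [IsManifold 𝓘(ℂ, E) ω X]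
  {F : Type*} [NormedAddCommGroup F] [NormedSpace ℂ F] [FiniteDimensional ℂ F]
  {V : X → Type*} [TopologicalSpace (TotalSpace F V)] [∀ x, AddCommGroup (V x)]
  [∀ x, Module ℂ (V x)] [∀ x, TopologicalSpace (V x)] [FiberBundle F V]
  [VectorBundle ℂ F V] [ContMDiffVectorBundle ∞ F V 𝓘(ℝ, E)]

theorem IsSmoothEndForm.add {A B : EndForm E V} (hA : IsSmoothEndForm F A)
    (hB : IsSmoothEndForm F B) : IsSmoothEndForm F (fun x => A x + B x) :=
  fun Y hY => (hA Y hY).add (hB Y hY)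

theorem IsSmoothEndForm.sub {A B : EndForm E V} (hA : IsSmoothEndForm F A)
    (hB : IsSmoothEndForm F B) : IsSmoothEndForm F (fun x => A x - B x) :=
  fun Y hY => (hA Y hY).sub (hB Y hY)

theorem IsSmoothEndForm.two_smul {A : EndForm E V} (hA : IsSmoothEndForm F A) :
    IsSmoothEndForm F (fun x => (2 : ℝ) • A x) := by
  simpa only [_root_.two_smul] using hA.add hA

theorem IsSmoothEndForm.mulLeft {A : EndForm E V} (hA : IsSmoothEndForm F A) {φ : EndSection V}
    (hφ : IsSmoothEnd E F φ) :
    IsSmoothEndForm F (fun x => (LinearMap.mulLeft ℝ (φ x)).comp (A x)) :=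
  fun Y hY => hφ.mul (hA Y hY)

theorem IsSmoothEndForm.mulRight {A : EndForm E V} (hA : IsSmoothEndForm F A) {φ : EndSection V}
    (hφ : IsSmoothEnd E F φ) :
    IsSmoothEndForm F (fun x => (LinearMap.mulRight ℝ (φ x)).comp (A x)) :=
  fun Y hY => (hA Y hY).mul hφ

theorem HermitianMetric.adj_eq_self (H : HermitianMetric E F V) {x : X} {A : Module.End ℂ (V x)}
    (hA : ∀ u w, H.form x (A u) w = H.form x u (A w)) : H.adj x A = A := by
  refine LinearMap.ext fun w => H.ext_form fun u => ?_
  rw [H.symm, ← H.form_adj, hA, ← H.symm]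

variable (H₁ H₂ : HermitianMetric E F V)

/-- Half the covariant derivative of the endomorphism relating two metrics. -/
def relForm (ψ₁ ψ₂ : EndForm E V) : EndForm E V := fun x =>
  (LinearMap.mulRight ℝ (H₁.rel H₂ x)).comp (ψ₁ x) - (LinearMap.mulLeft ℝ (H₁.rel H₂ x)).comp (ψ₂ x)

/-- The metric trace of `tr (P (ψ₁ - ψ₂))`, where `P` is half the covariant derivative of the
relative endomorphism, is nonnegative, and it vanishes only where `ψ₁ = ψ₂`. -/
theorem gTrace_relForm_nonneg (κ : KahlerForm E X) {ψ₁ ψ₂ : EndForm E V} {x : X}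
    (h₁ : ∀ v u w, H₁.form x (ψ₁ x v u) w = H₁.form x u (ψ₁ x v w))
    (h₂ : ∀ v u w, H₂.form x (ψ₂ x v u) w = H₂.form x u (ψ₂ x v w)) :
    0 ≤ (κ.gTrace x (fun u v =>
        pairing (relForm H₁ H₂ ψ₁ ψ₂) (fun x => ψ₁ x - ψ₂ x) x u v)).re ∧
      ((κ.gTrace x (fun u v =>
        pairing (relForm H₁ H₂ ψ₁ ψ₂) (fun x => ψ₁ x - ψ₂ x) x u v)).re = 0 → ψ₁ x - ψ₂ x = 0) := by
  obtain ⟨n, e, he⟩ := H₁.exists_basis_trace x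
  set T := H₁.rel H₂ x with hT
  set d : RT E x →ₗ[ℝ] Module.End ℂ (V x) := ψ₁ x - ψ₂ x with hd
  set Q := pairing (relForm H₁ H₂ ψ₁ ψ₂) (fun x => ψ₁ x - ψ₂ x) x with hQ
  -- The trace is taken in an `H₁`-unitary basis; `ψ₁` is moved across `H₁`, `h` turns `H₁` into
  -- `H₂`, and `ψ₂` is moved across `H₂`.
  have hdiag : ∀ u, Q u u = ∑ i, H₂.form x (d u (e i)) (d u (e i)) := by
    intro u
    rw [hQ, pairing_apply, he]
    refine Finset.sum_congr rfl fun i _ => ?_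
    change H₁.form x (ψ₁ x u (T (d u (e i))) - T (ψ₂ x u (d u (e i)))) (e i) = _
    rw [map_sub, LinearMap.sub_apply, h₁, H₁.form_rel, H₁.form_rel, h₂, ← map_sub]
    rfl
  have hpos : ∀ w, 0 ≤ (H₂.form x w w).re := fun w => by
    by_cases hw : w = 0
    · simp [hw]
    · exact (H₂.pos x w hw).le
  have hre : (κ.gTrace x (fun u v => Q u v)).re =
      basisTrace (κ.metricₗ x) (Module.finBasis ℝ E : Module.Basis _ ℝ (RT E x))
        (Q.compr₂ Complex.reLm) := by
    rw [κ.gTrace_eq_basisTrace x Q (Module.finBasis ℝ E : Module.Basis _ ℝ (RT E x))]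
    simp only [basisTrace, Complex.re_sum, Complex.smul_re]
    rfl
  rw [hre]
  refine basisTrace_nonneg (κ.metricₗ x) (κ.metric_symm x) (κ.metric_pos x) _ _ d ?_ ?_
  · intro u
    change 0 ≤ (Q u u).re
    rw [hdiag, Complex.re_sum]
    exact Finset.sum_nonneg fun i _ => hpos _
  · intro u hu
    change (Q u u).re = 0 at hu
    rw [hdiag, Complex.re_sum, Finset.sum_eq_zero_iff_of_nonneg fun i _ => hpos _] at hu
    refine e.ext fun i => ?_
    by_contra hne
    exact (H₂.pos x _ hne).ne' (hu i (Finset.mem_univ i))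

/-- The difference of the two first variation integrands for the relative endomorphism. -/
theorem gTrace_sub_gTrace (κ : KahlerForm E X) (ψ₁ ψ₂ : EndForm E V) (x : X) :
    κ.gTrace x (fun u v => pairing (fun x =>
      (LinearMap.mulRight ℝ (H₁.rel H₂ x)).comp (ψ₁ x) +
        (LinearMap.mulLeft ℝ (H₁.rel H₂ x)).comp (ψ₁ x) -
        (2 : ℝ) • (LinearMap.mulLeft ℝ (H₁.rel H₂ x)).comp (ψ₂ x)) ψ₁ x u v) -
    κ.gTrace x (fun u v => pairing (fun x =>
      (2 : ℝ) • (LinearMap.mulRight ℝ (H₁.rel H₂ x)).comp (ψ₁ x) -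
        (LinearMap.mulLeft ℝ (H₁.rel H₂ x)).comp (ψ₂ x) -
        (LinearMap.mulRight ℝ (H₁.rel H₂ x)).comp (ψ₂ x)) ψ₂ x u v) =
    2 * κ.gTrace x (fun u v =>
      pairing (relForm H₁ H₂ ψ₁ ψ₂) (fun x => ψ₁ x - ψ₂ x) x u v) := by
  set A : EndForm E V := fun x =>
      (LinearMap.mulRight ℝ (H₁.rel H₂ x)).comp (ψ₁ x) +
        (LinearMap.mulLeft ℝ (H₁.rel H₂ x)).comp (ψ₁ x) -
        (2 : ℝ) • (LinearMap.mulLeft ℝ (H₁.rel H₂ x)).comp (ψ₂ x) with hA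
  set B : EndForm E V := fun x =>
      (2 : ℝ) • (LinearMap.mulRight ℝ (H₁.rel H₂ x)).comp (ψ₁ x) -
        (LinearMap.mulLeft ℝ (H₁.rel H₂ x)).comp (ψ₂ x) -
        (LinearMap.mulRight ℝ (H₁.rel H₂ x)).comp (ψ₂ x) with hB
  have : FiniteDimensional ℂ (V x) := finiteDimensional_fiber F x
  let b : Module.Basis _ ℝ (RT E x) := (Module.finBasis ℝ E : Module.Basis _ ℝ (RT E x))
  set g := κ.metricₗ x
  set P := pairing (relForm H₁ H₂ ψ₁ ψ₂) (fun x => ψ₁ x - ψ₂ x) x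
  -- By cyclicity, `tr(h ψᵢ(u) ψᵢ(v))` and `tr(ψᵢ(u) h ψᵢ(v))` differ only by exchanging `u` and
  -- `v`; `R₁` and `R₂` record these terms, and their antisymmetric parts have zero metric trace.
  let R₁ := pairing (fun x => (LinearMap.mulLeft ℝ (H₁.rel H₂ x)).comp (ψ₁ x)) ψ₁ x
  let R₂ := pairing (fun x => (LinearMap.mulRight ℝ (H₁.rel H₂ x)).comp (ψ₂ x)) ψ₂ x
  have hsplit : (pairing A ψ₁ x - pairing B ψ₂ x) - (P + P) =
      (R₁ - R₁.flip) - (R₂.flip - R₂) := by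
    refine LinearMap.ext fun u => LinearMap.ext fun v => ?_
    simp only [LinearMap.sub_apply, LinearMap.add_apply, LinearMap.flip_apply, P, R₁, R₂,
      pairing_apply, relForm, hA, hB, LinearMap.comp_apply, LinearMap.mulLeft_apply,
      LinearMap.mulRight_apply, _root_.two_smul]
    simp only [add_mul, sub_mul, mul_sub, map_add, map_sub]
    set T := H₁.rel H₂ x
    have c₁ := LinearMap.trace_mul_cycle ℂ T (ψ₁ x v) (ψ₁ x u)
    have c₂ := LinearMap.trace_mul_cycle ℂ T (ψ₂ x u) (ψ₂ x v)
    linear_combination c₁ - c₂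
  have hz : basisTrace g b ((R₁ - R₁.flip) - (R₂.flip - R₂)) = 0 := by
    rw [basisTrace_sub, basisTrace_sub, basisTrace_sub, basisTrace_flip g (κ.metric_symm x),
      basisTrace_flip g (κ.metric_symm x), sub_self, sub_self, sub_self]
  rw [← hsplit, basisTrace_sub, basisTrace_sub] at hz
  rw [κ.gTrace_eq_basisTrace x (pairing A ψ₁ x) b, κ.gTrace_eq_basisTrace x (pairing B ψ₂ x) b,
    κ.gTrace_eq_basisTrace x P b]
  have hadd : basisTrace g b (P + P) = 2 * basisTrace g b P := by
    simp [basisTrace, smul_add, Finset.sum_add_distrib, two_mul]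
  rw [hadd] at hz
  exact sub_eq_zero.1 hz

variable [CompactSpace X] [T2Space X]
  [MeasurableSpace E] [BorelSpace E] [MeasurableSpace X] [BorelSpace X]

/-- The first variation formula of a harmonic metric. -/
theorem integral_gTrace_eq_zero {κ : KahlerForm E X} {H : HermitianMetric E F V} {D : Nabla E V}
    {ψ : EndForm E V} (hψ : IsSelfAdjointPart D H ψ)
    (hc : IsCodifferential κ H (subForm D ψ) ψ 0) {φ : EndSection V} (hφ : IsSmoothEnd E F φ)
    {Dφ : EndForm E V} (hD : IsEndDeriv F (subForm D ψ) φ Dφ) :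
    ∫ x, κ.gTrace x (fun u v => pairing Dφ ψ x u v) ∂κ.volume = 0 := by
  have h := hc φ Dφ hφ hD
  -- Self-adjointness of `ψ` removes `H` from the integrand, so the formulas for two different
  -- metrics can be subtracted.
  have hadj : ∀ x v, H.adj x (ψ x v) = ψ x v := fun x v =>
    H.adj_eq_self fun u w => hψ.selfAdjoint x v u w
  have h0 : ∀ x, H.adj x 0 = 0 := fun x => H.adj_eq_self fun u w => by simp
  simp only [HermitianMetric.endInner, hadj, Pi.zero_apply, h0, LinearMap.comp_zero, map_zero,
    integral_zero] at h
  exact h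

/-- The self-adjoint parts of a connection for two harmonic metrics coincide. -/
theorem selfAdjointPart_eq {κ : KahlerForm E X} {D : Nabla E V} {ψ₁ ψ₂ : EndForm E V}
    (h₁ : IsSelfAdjointPart D H₁ ψ₁) (h₂ : IsSelfAdjointPart D H₂ ψ₂)
    (hc₁ : IsCodifferential κ H₁ (subForm D ψ₁) ψ₁ 0)
    (hc₂ : IsCodifferential κ H₂ (subForm D ψ₂) ψ₂ 0) : ψ₁ = ψ₂ := by
  have hh := H₁.isSmoothEnd_rel H₂
  have hfin := κ.isFiniteMeasure_volume
  have hpos := κ.isOpenPosMeasure_volume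
  have z₁ := integral_gTrace_eq_zero h₁ hc₁ hh (isEndDeriv_rel_left h₁ h₂)
  have z₂ := integral_gTrace_eq_zero h₂ hc₂ hh (isEndDeriv_rel_right h₁ h₂)
  have c₁ := continuous_gTrace_pairing κ (((h₁.smooth.mulRight hh).add (h₁.smooth.mulLeft hh)).sub
    (h₂.smooth.mulLeft hh).two_smul) h₁.smooth
  have c₂ := continuous_gTrace_pairing κ ((((h₁.smooth.mulRight hh).two_smul).sub
    (h₂.smooth.mulLeft hh)).sub (h₂.smooth.mulRight hh)) h₂.smooth
  have c₃ : Continuous fun x => κ.gTrace x (fun u v =>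
      pairing (relForm H₁ H₂ ψ₁ ψ₂) (fun x => ψ₁ x - ψ₂ x) x u v) :=
    continuous_gTrace_pairing κ ((h₁.smooth.mulRight hh).sub (h₂.smooth.mulLeft hh))
      (h₁.smooth.sub h₂.smooth)
  have hint : ∀ {f : X → ℂ}, Continuous f → Integrable f κ.volume := fun hf =>
    hf.integrable_of_hasCompactSupport (HasCompactSupport.of_compactSpace _)
  have z₃ := integral_sub (hint c₁) (hint c₂)
  rw [z₁, z₂, sub_self] at z₃
  simp only [gTrace_sub_gTrace] at z₃
  rw [integral_const_mul] at z₃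
  have z₄ := (mul_eq_zero.1 z₃).resolve_left two_ne_zero
  have z₅ := congrArg Complex.re z₄
  rw [← Complex.reCLM_apply, ← ContinuousLinearMap.integral_comp_comm _ (hint c₃)] at z₅
  simp only [Complex.reCLM_apply, Complex.zero_re] at z₅
  have hnn := fun x => gTrace_relForm_nonneg H₁ H₂ κ (h₁.selfAdjoint x) (h₂.selfAdjoint x)
  have c₄ := Complex.continuous_re.comp c₃
  rw [integral_eq_zero_iff_of_nonneg (fun x => (hnn x).1) (hint c₃).re] at z₅
  -- Continuity and positivity of the volume on open sets turn almost everywhere into everywhere.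
  have z₆ := (Continuous.ae_eq_iff_eq κ.volume c₄ continuous_zero).1 z₅
  funext x
  exact sub_eq_zero.1 ((hnn x).2 (congrFun z₆ x))

end Uniqueness

end NHYM

end

/-! ### Conclusion: harmonic metrics are proportional -/

theorem mainTheorem4
    {E : Type*} [NormedAddCommGroup E] [NormedSpace ℂ E] [FiniteDimensional ℂ E]
    [MeasurableSpace E] [BorelSpace E]
    {X : Type*} [TopologicalSpace X] [ChartedSpace E X] [IsManifold 𝓘(ℂ, E) ω X]
    [CompactSpace X] [ConnectedSpace X] [T2Space X] [MeasurableSpace X] [BorelSpace X]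
    {F : Type*} [NormedAddCommGroup F] [NormedSpace ℂ F] [FiniteDimensional ℂ F]
    {V : X → Type*} [TopologicalSpace (TotalSpace F V)] [∀ x, AddCommGroup (V x)]
    [∀ x, Module ℂ (V x)] [∀ x, TopologicalSpace (V x)]
    [∀ x, IsTopologicalAddGroup (V x)] [∀ x, ContinuousSMul ℂ (V x)]
    [FiberBundle F V] [VectorBundle ℂ F V] [ContMDiffVectorBundle ∞ F V 𝓘(ℝ, E)]
    (κ : NHYM.KahlerForm E X) (D : CovariantDerivative 𝓘(ℝ, E) F V)
    (hD : NHYM.IsNHYM κ D) (hsimple : NHYM.IsSimple F (NHYM.toNabla D))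
    (H₁ H₂ : NHYM.HermitianMetric E F V)
    (hH₁ : NHYM.IsHarmonic κ (NHYM.toNabla D) H₁)
    (hH₂ : NHYM.IsHarmonic κ (NHYM.toNabla D) H₂) :
    ∃ c : ℝ, ∀ (x : X) (u v : V x),
      H₁.form x u v = (Real.exp c : ℂ) * H₂.form x u v := by
  obtain ⟨ψ₁, h₁, hc₁⟩ := hH₁
  obtain ⟨ψ₂, h₂, hc₂⟩ := hH₂
  obtain rfl := NHYM.selfAdjointPart_eq H₁ H₂ h₁ h₂ hc₁ hc₂
  -- The form `ψ₁` is now self-adjoint for both metrics, hence commutes with the endomorphism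
  -- relating them.
  have hcomm : ∀ x v u, ψ₁ x v (H₁.rel H₂ x u) = H₁.rel H₂ x (ψ₁ x v u) := by
    intro x v u
    refine H₁.ext_form fun w => ?_
    rw [h₁.selfAdjoint, H₁.form_rel, H₁.form_rel, h₂.selfAdjoint]
  have hpar : NHYM.IsParallel D (H₁.rel H₂) := by
    refine ⟨H₁.isSmoothEnd_rel H₂, fun σ x v hσ => ?_⟩
    have := NHYM.nabla_rel h₁ h₂ hσ v
    rwa [hcomm, sub_self, smul_zero, add_zero] at this
  obtain ⟨μ, hμ⟩ := NHYM.IsSimple.eq_smul_of_isParallel hD.connection hsimple H₁ hpar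
    (H₁.rel_selfAdjoint H₂)
  have hrel : ∀ x u v, H₂.form x u v = μ * H₁.form x u v := by
    intro x u v
    rw [← H₁.form_rel H₂, hμ, map_smul, LinearMap.smul_apply, smul_eq_mul]
  -- For the zero bundle nothing determines `μ`; otherwise one nonzero vector does.
  by_cases htriv : ∀ (x : X) (u : V x), u = 0
  · exact ⟨0, fun x u v => by simp [htriv x u]⟩
  push Not at htriv
  obtain ⟨x₀, u₀, hu₀⟩ := htriv
  have hreal : ∀ H : NHYM.HermitianMetric E F V,
      H.form x₀ u₀ u₀ = ((H.form x₀ u₀ u₀).re : ℂ) := fun H =>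
    (Complex.conj_eq_iff_re.1 (H.symm x₀ u₀ u₀).symm).symm
  have p₁ := H₁.pos x₀ u₀ hu₀
  have p₂ := H₂.pos x₀ u₀ hu₀
  -- This is the inverse of `μ`, seen to be real and positive; the constant is `c = log r`.
  set r := (H₁.form x₀ u₀ u₀).re / (H₂.form x₀ u₀ u₀).re
  have hr : 0 < r := div_pos p₁ p₂
  have hrμ : (r : ℂ) * μ = 1 := by
    have h := hrel x₀ u₀ u₀
    rw [hreal H₁, hreal H₂] at h
    have n₁ : ((H₁.form x₀ u₀ u₀).re : ℂ) ≠ 0 := by exact_mod_cast p₁.ne'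
    have n₂ : ((H₂.form x₀ u₀ u₀).re : ℂ) ≠ 0 := by exact_mod_cast p₂.ne'
    simp only [r, Complex.ofReal_div]
    field_simp
    rw [h]
    ring
  refine ⟨Real.log r, fun x u v => ?_⟩
  rw [Real.exp_log hr, hrel, ← mul_assoc, hrμ, one_mul]
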